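/- Let $K$ be a field and let $(A,m,\delta,\varepsilon)$ be a counital nearly Frobenius algebra over $K$: $A$ is a possibly infinite-dimensional, not necessarily unital, associative $K$-algebra with a coassociative comultiplication $\delta:A\to A\otimes A$ with counit $\varepsilon:A\to K$, such that $(m\otimes 1)(1\otimes\delta)=\delta m=(1\otimes m)(\delta\otimes 1)$. An *Almost TQFT* on $A$ is a system of linear maps $\omega_{g,n,m}:A^{\otimes n}\to A^{\otimes m}$ ($g,m\ge 0$, $n\ge 1$; the values on connected cobordisms of genus $g$ with $n$ incoming and $m$ outgoing circles) such that - $\omega_{0,1,1}=\mathrm{id}$, $\omega_{0,1,0}=\varepsilon$, $\omega_{0,2,1}=m$, $\omega_{0,1,2}=\delta$; - each $\omega_{g,n,m}$ is invariant under permutations of the inputs and of the outputs; - (sewing) $\omega_{h,k,m}\circ\omega_{g,n,k}=\omega_{g+h+k-1,n,m}$ for $k\ge1$, and, for every $j\ge 1$, sewing $j$ outputs of $\omega_{g,n,\ell}$ to $j$ inputs of $\omega_{h,k,m}$ gives $\omega_{g+h+j-1,\,n+k-j,\,\ell+m-j}$. A *two-colored cell graph* of type $(g,n,m)$ is a connected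 ribbon graph of genus $g$ (i.e. $V-E+F=2-2g$) with $n\ge 1$ labeled red vertices (inputs) and $m\ge 0$ labeled blue vertices (outputs). A *ribbon TQFT* on $A$ is an assignment $\gamma\mapsto\Omega(\gamma)\in\mathrm{Hom}(A^{\otimes n},A^{\otimes m})$, for $\gamma$ of every type $(g,n,m)$, invariant under isomorphisms and equivariant under relabelings, that satisfies the Edge Contraction/Construction axioms: - $\Omega(\gamma)=\varepsilon$ if $\gamma$ is a single red vertex without edges. - If $\gamma'$ is $\gamma$ with an edge between two red vertices contracted, $\Omega(\gamma)$ is $\Omega(\gamma')$ precomposed with $m$ on the two inputs; if the edge joins two blue vertices, $\Omega(\gamma)$ is $\Omega(\gamma')$ followed by $\delta$ on the merged output. - If the edge joins a red vertex with input $v$ and a blue vertex: when it is contracted to a red vertex, $\Omega(\gamma)$ is obtained by applying $\delta$ to $v$, taking one factor as the blue output and the other as the input of $\Omega(\gamma')$ at the merged vertex; when it is contracted to a blue vertex (and $\gamma'$ still has a red vertex), $\Omega(\gamma)$ is $\Omega(\gamma')$ with its output at the merged vertex multiplied by $v$. - If a loop at a red vertex is contracted, so that the vertex splits in two, then $\Omega(\gamma)$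 is $\Omega(\gamma')$ precomposed with $\delta$ at that input if the resulting graph $\gamma'$ is connected, and $\Omega(\gamma_1)\otimes\Omega(\gamma_2)$ precomposed with $\delta$ at that input if the result is a disjoint union $\gamma_1\sqcup\gamma_2$. - If a loop at a blue vertex is contracted, then $\Omega(\gamma)$ is $\Omega(\gamma')$ followed by $m$ on the two new outputs if the result $\gamma'$ is connected, and $\Omega(\gamma_1)\otimes\Omega(\gamma_2)$ followed by $m$ on the two new outputs if it is a disjoint union $\gamma_1\sqcup\gamma_2$ in which both parts have red vertices. Then the two sets of axioms are equivalent. A system $(\omega_{g,n,m})$ is an Almost TQFT on $A$ if and only if the assignment $\Omega(\gamma):=\omega_{g,n,m}$, for $\gamma$ of type $(g,n,m)$, is a ribbon TQFT on $A$; and every ribbon TQFT on $A$ is of this form for exactly one Almost TQFT $(\omega_{g,n,m})$ on $A$. -/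

import Mathlib

open scoped TensorProduct

/-! ### Counital nearly Frobenius algebras -/

/-- A counital nearly Frobenius algebra over a field `K`: a possibly infinite-dimensional, not
necessarily unital, associative algebra `A` with a coassociative comultiplication `δ` and a counit
`ε` (Mathlib's `Coalgebra`) such that `δ` is a map of bimodules, that is, the Frobenius relation
`(m ⊗ 1) ∘ (1 ⊗ δ) = δ ∘ m = (1 ⊗ m) ∘ (δ ⊗ 1)` holds. -/
structure IsNearlyFrobenius (K A : Type*) [Field K] [NonUnitalRing A] [Module K A]
    [IsScalarTower K A A] [SMulCommClass K A A] [Coalgebra K A] : Prop where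
  left_frobenius :
    (LinearMap.mul' K A).rTensor A ∘ₗ (TensorProduct.assoc K A A A).symm.toLinearMap ∘ₗ
        (CoalgebraStruct.comul (R := K) (A := A)).lTensor A =
      CoalgebraStruct.comul ∘ₗ LinearMap.mul' K A
  right_frobenius :
    (LinearMap.mul' K A).lTensor A ∘ₗ (TensorProduct.assoc K A A A).toLinearMap ∘ₗ
        (CoalgebraStruct.comul (R := K) (A := A)).rTensor A =
      CoalgebraStruct.comul ∘ₗ LinearMap.mul' K A

/-! ### Linear maps between tensor powers -/

namespace TensorOps

section LinearPart

variable (K A : Type*) [Field K] [AddCommGroup A] [Module K A]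

/-- `a ⊗ (v₁ ⊗ ⋯ ⊗ vₙ) ↦ a ⊗ v₁ ⊗ ⋯ ⊗ vₙ`. -/
noncomputable def cons (n : ℕ) : A ⊗[K] ⨂[K]^n A →ₗ[K] ⨂[K]^(n + 1) A :=
  TensorProduct.lift (PiTensorProduct.lift.toLinearMap ∘ₗ
    (PiTensorProduct.tprod K : MultilinearMap K (fun _ : Fin (n + 1) => A) _).curryLeft)

/-- `v₀ ⊗ v₁ ⊗ ⋯ ⊗ vₙ ↦ v₀ ⊗ (v₁ ⊗ ⋯ ⊗ vₙ)`, the inverse of `cons`. -/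
noncomputable def uncons (n : ℕ) : ⨂[K]^(n + 1) A →ₗ[K] A ⊗[K] ⨂[K]^n A :=
  PiTensorProduct.lift (LinearMap.uncurryLeft (M := fun _ : Fin (n + 1) => A)
    (PiTensorProduct.lift.symm.toLinearMap ∘ₗ TensorProduct.mk K A (⨂[K]^n A)))

variable {K A}

theorem cons_tprod {n : ℕ} (a : A) (v : Fin n → A) :
    cons K A n (a ⊗ₜ[K] PiTensorProduct.tprod K v) =
      PiTensorProduct.tprod K (Fin.cons a v : Fin (n + 1) → A) := by
  simp [cons]

theorem uncons_tprod {n : ℕ} (v : Fin (n + 1) → A) :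
    uncons K A n (PiTensorProduct.tprod K v) =
      v 0 ⊗ₜ[K] PiTensorProduct.tprod K (Fin.tail v) := by
  simp [uncons]

/-- `id_A ⊗ F`. -/
noncomputable def idTensor {n m : ℕ} (F : ⨂[K]^n A →ₗ[K] ⨂[K]^m A) :
    ⨂[K]^(n + 1) A →ₗ[K] ⨂[K]^(m + 1) A :=
  cons K A m ∘ₗ F.lTensor A ∘ₗ uncons K A n

/-- The composite `(id_p ⊗ G) ∘ (F ⊗ id_k)`, in which the last `j` outputs of `F` become the
first `j` inputs of `G`. -/
noncomputable def partialComp {n p j k m : ℕ} (F : ⨂[K]^n A →ₗ[K] ⨂[K]^(p + j) A)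
    (G : ⨂[K]^(j + k) A →ₗ[K] ⨂[K]^m A) : ⨂[K]^(n + k) A →ₗ[K] ⨂[K]^(p + m) A :=
  TensorPower.mulEquiv.toLinearMap ∘ₗ
    (G ∘ₗ TensorPower.mulEquiv.toLinearMap).lTensor (⨂[K]^p A) ∘ₗ
    (TensorProduct.assoc K (⨂[K]^p A) (⨂[K]^j A) (⨂[K]^k A)).toLinearMap ∘ₗ
    (TensorPower.mulEquiv.symm.toLinearMap ∘ₗ F).rTensor (⨂[K]^k A) ∘ₗ
    TensorPower.mulEquiv.symm.toLinearMap

end LinearPart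

section FrobeniusPart

variable (K A : Type*) [Field K] [NonUnitalRing A] [Module K A]
    [IsScalarTower K A A] [SMulCommClass K A A]

/-- `v₀ ⊗ v₁ ⊗ v₂ ⊗ ⋯ ↦ v₀v₁ ⊗ v₂ ⊗ ⋯`. -/
noncomputable def mulHead (n : ℕ) : ⨂[K]^(n + 2) A →ₗ[K] ⨂[K]^(n + 1) A :=
  cons K A n ∘ₗ (LinearMap.mul' K A).rTensor (⨂[K]^n A) ∘ₗ
    (TensorProduct.assoc K A A (⨂[K]^n A)).symm.toLinearMap ∘ₗ
    (uncons K A n).lTensor A ∘ₗ uncons K A (n + 1)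

/-- `(x ⊗ v) ⊗ (y ⊗ w) ↦ xy ⊗ v ⊗ w`. -/
noncomputable def mulPair (n₁ n₂ : ℕ) :
    ⨂[K]^(n₁ + 1) A ⊗[K] ⨂[K]^(n₂ + 1) A →ₗ[K] ⨂[K]^(n₁ + n₂ + 1) A :=
  cons K A (n₁ + n₂) ∘ₗ
    TensorProduct.map (LinearMap.mul' K A) TensorPower.mulEquiv.toLinearMap ∘ₗ
    (TensorProduct.tensorTensorTensorComm K A (⨂[K]^n₁ A) A (⨂[K]^n₂ A)).toLinearMap ∘ₗ
    TensorProduct.map (uncons K A n₁) (uncons K A n₂)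

variable [Coalgebra K A]

/-- `v₀ ⊗ v₁ ⊗ ⋯ ↦ δ(v₀) ⊗ v₁ ⊗ ⋯`. -/
noncomputable def comulHead (n : ℕ) : ⨂[K]^(n + 1) A →ₗ[K] ⨂[K]^(n + 2) A :=
  cons K A (n + 1) ∘ₗ (cons K A n).lTensor A ∘ₗ
    (TensorProduct.assoc K A A (⨂[K]^n A)).toLinearMap ∘ₗ
    (CoalgebraStruct.comul (R := K) (A := A)).rTensor (⨂[K]^n A) ∘ₗ uncons K A n

/-- `a ⊗ v ⊗ w ↦ ∑ (a' ⊗ v) ⊗ (a'' ⊗ w)` for `δ(a) = ∑ a' ⊗ a''`. -/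
noncomputable def comulPair (n₁ n₂ : ℕ) :
    ⨂[K]^(n₁ + n₂ + 1) A →ₗ[K] ⨂[K]^(n₁ + 1) A ⊗[K] ⨂[K]^(n₂ + 1) A :=
  TensorProduct.map (cons K A n₁) (cons K A n₂) ∘ₗ
    (TensorProduct.tensorTensorTensorComm K A A (⨂[K]^n₁ A) (⨂[K]^n₂ A)).toLinearMap ∘ₗ
    TensorProduct.map (CoalgebraStruct.comul (R := K) (A := A))
      TensorPower.mulEquiv.symm.toLinearMap ∘ₗ
    uncons K A (n₁ + n₂)

/-- The counit `ε`, as a map `A^{⊗1} → A^{⊗0}`. -/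
noncomputable def counitOne : ⨂[K]^1 A →ₗ[K] ⨂[K]^0 A :=
  (TensorProduct.lid K (⨂[K]^0 A)).toLinearMap ∘ₗ
    (CoalgebraStruct.counit (R := K) (A := A)).rTensor (⨂[K]^0 A) ∘ₗ uncons K A 0

end FrobeniusPart

end TensorOps

/-! ### Almost TQFTs -/

/-- A system of linear maps `ω_{g,n,m} : A^{⊗n} → A^{⊗m}`, one for each topological type of
connected cobordism with genus `g`, `n ≥ 1` incoming and `m ≥ 0` outgoing boundary circles. -/
def CobordismMaps (K A : Type*) [Field K] [AddCommGroup A] [Module K A] : Type _ :=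
  ∀ g n m : ℕ, 0 < n → (⨂[K]^n A →ₗ[K] ⨂[K]^m A)

/-- The functorial axioms for an Almost TQFT with underlying counital nearly Frobenius algebra
`A`. -/
structure IsAlmostTQFT {K A : Type*} [Field K] [NonUnitalRing A] [Module K A]
    [IsScalarTower K A A] [SMulCommClass K A A] [Coalgebra K A] (ω : CobordismMaps K A) :
    Prop where
  /-- The cylinder. -/
  cylinder : ω 0 1 1 one_pos = LinearMap.id
  /-- The incoming disk. -/
  disk : ω 0 1 0 one_pos = TensorOps.counitOne K A
  /-- The pair of pants with two incoming circles. -/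
  pants : ω 0 2 1 two_pos = TensorOps.mulHead K A 0
  /-- The pair of pants with two outgoing circles. -/
  copants : ω 0 1 2 one_pos = TensorOps.comulHead K A 0
  /-- Invariance under permutations of the incoming and of the outgoing circles. -/
  symmetry : ∀ (g n m : ℕ) (hn : 0 < n) (σ : Equiv.Perm (Fin n)) (τ : Equiv.Perm (Fin m))
    (v : ⨂[K]^n A),
    ω g n m hn (PiTensorProduct.reindex K (fun _ => A) σ v) =
      PiTensorProduct.reindex K (fun _ => A) τ (ω g n m hn v)
  /-- Sewing all outgoing circles of one surface to all incoming circles of another. -/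
  sewing : ∀ (g h n k m : ℕ) (hn : 0 < n),
    ω h (k + 1) m k.succ_pos ∘ₗ ω g n (k + 1) hn = ω (g + h + k) n m hn
  /-- Sewing `j + 1 ≥ 1` of the outgoing circles of one surface to incoming circles of another. -/
  partial_sewing : ∀ (g h n p j k m : ℕ) (hn : 0 < n),
    TensorOps.partialComp (ω g n (p + (j + 1)) hn)
        (ω h (j + 1 + k) m (Nat.add_pos_left j.succ_pos k)) =
      ω (g + h + j) (n + k) (p + m) (Nat.add_pos_left hn k)

/-! ### Ribbon graphs -/

/-- A (not necessarily connected) ribbon graph with vertex set `V`. The edges are the orbits of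
`opp`; `next` is the cyclic order of the half-edges around each vertex. A vertex may carry no
half-edge. -/
structure CellGraph (V : Type) where
  HalfEdge : Type
  finite : Finite HalfEdge
  /-- The other half of the same edge. -/
  opp : Equiv.Perm HalfEdge
  opp_opp : ∀ x, opp (opp x) = x
  opp_ne : ∀ x, opp x ≠ x
  /-- The next half-edge in the cyclic order at the same vertex. -/
  next : Equiv.Perm HalfEdge
  /-- The vertex at which a half-edge is attached. -/
  vert : HalfEdge → V
  sameCycle_iff : ∀ x y, next.SameCycle x y ↔ vert x = vert y

namespace CellGraph

/-- The number of orbits of a permutation, fixed points included. -/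
noncomputable def numOrbits {X : Type} (σ : Equiv.Perm X) : ℕ :=
  Nat.card (Quotient (Equiv.Perm.SameCycle.setoid σ))

variable {V V' : Type}

noncomputable def numEdges (γ : CellGraph V) : ℕ := numOrbits γ.opp

/-- The number of boundary cycles; a vertex without half-edges contributes one. -/
noncomputable def numFaces (γ : CellGraph V) : ℕ :=
  numOrbits (γ.next * γ.opp) + Nat.card {v : V // ∀ x, γ.vert x ≠ v}

def Connected (γ : CellGraph V) : Prop :=
  ∀ v w : V, Relation.ReflTransGen (fun a b => ∃ x, γ.vert x = a ∧ γ.vert (γ.opp x) = b) v w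

/-- The disjoint union of two ribbon graphs. -/
def disjUnion (γ₁ : CellGraph V) (γ₂ : CellGraph V') : CellGraph (V ⊕ V') where
  HalfEdge := γ₁.HalfEdge ⊕ γ₂.HalfEdge
  finite := by
    have := γ₁.finite
    have := γ₂.finite
    infer_instance
  opp := Equiv.sumCongr γ₁.opp γ₂.opp
  opp_opp := by
    rintro (x | x)
    · simp [γ₁.opp_opp]
    · simp [γ₂.opp_opp]
  opp_ne := by
    rintro (x | x)
    · simp [γ₁.opp_ne]
    · simp [γ₂.opp_ne]
  next := Equiv.sumCongr γ₁.next γ₂.next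
  vert := Sum.map γ₁.vert γ₂.vert
  sameCycle_iff := by
    have key : ∀ n : ℤ, (Equiv.sumCongr γ₁.next γ₂.next : Equiv.Perm _) ^ n =
        Equiv.sumCongr (γ₁.next ^ n) (γ₂.next ^ n) := fun n =>
      (map_zpow (Equiv.Perm.sumCongrHom γ₁.HalfEdge γ₂.HalfEdge)
        (γ₁.next, γ₂.next) n).symm
    rintro (x | x) (y | y)
    · simp [Equiv.Perm.SameCycle, key, ← γ₁.sameCycle_iff]
    · simp [Equiv.Perm.SameCycle, key]
    · simp [Equiv.Perm.SameCycle, key]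
    · simp [Equiv.Perm.SameCycle, key, ← γ₂.sameCycle_iff]

/-- `e` is an isomorphism of ribbon graphs that acts on vertices by `f`. -/
structure IsIso (γ : CellGraph V) (γ' : CellGraph V') (f : V ≃ V')
    (e : γ.HalfEdge ≃ γ'.HalfEdge) : Prop where
  opp : ∀ x, e (γ.opp x) = γ'.opp (e x)
  next : ∀ x, e (γ.next x) = γ'.next (e x)
  vert : ∀ x, γ'.vert (e x) = f (γ.vert x)

/-- The cyclic orders after contracting the edge with halves `x` and `opp x`, before these two
half-edges are deleted: if the edge joins two vertices with cyclic orders `(x a₁ … aₖ)` and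
`(opp x b₁ … bₗ)`, these are merged to `(x b₁ … bₗ opp x a₁ … aₖ)`; if it is a loop at a vertex
with cyclic order `(x a₁ … aₖ opp x b₁ … bₗ)`, this is split into `(x b₁ … bₗ)` and
`(opp x a₁ … aₖ)`. -/
noncomputable def contractedNext (γ : CellGraph V) (x : γ.HalfEdge) :
    Equiv.Perm γ.HalfEdge :=
  open Classical in γ.next * Equiv.swap x (γ.opp x)

/-- `e` identifies the half-edges of `γ'` with those of `γ` other than `x` and `opp x`, in such a
way that the edges and the cyclic orders of `γ'` are obtained from those of `γ` by contracting the
edge with halves `x` and `opp x`. Vertices are not yet taken into account. -/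
structure IsContraction (γ : CellGraph V) (γ' : CellGraph V') (x : γ.HalfEdge)
    (e : γ'.HalfEdge → γ.HalfEdge) : Prop where
  injective : Function.Injective e
  mem_range : ∀ y, y ∈ Set.range e ↔ y ≠ x ∧ y ≠ γ.opp x
  opp : ∀ y, e (γ'.opp y) = γ.opp (e y)
  next : ∀ y, ∃ k : ℕ, (γ.contractedNext x ^ (k + 1)) (e y) = e (γ'.next y) ∧
    ∀ i < k, (γ.contractedNext x ^ (i + 1)) (e y) ∉ Set.range e

/-- `γ'` is obtained from `γ` by contracting an edge joining the vertices `v` and `w`. Here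
`f : V → V'` is the identification of vertices in which `v` and `w` have the same image. -/
def EdgeContraction (γ : CellGraph V) (γ' : CellGraph V') (v w : V) (f : V → V') : Prop :=
  ∃ (x : γ.HalfEdge) (e : γ'.HalfEdge → γ.HalfEdge),
    γ.vert x = v ∧ γ.vert (γ.opp x) = w ∧ γ.IsContraction γ' x e ∧
      ∀ y, γ'.vert y = f (γ.vert (e y))

/-- `γ'` is obtained from `γ` by contracting a loop at the vertex `v`, which splits `v` into two
vertices. Here `f : V' → V` is the map of vertices that sends these two vertices to `v`. -/
def LoopContraction (γ : CellGraph V) (γ' : CellGraph V') (v : V) (f : V' → V) : Prop :=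
  ∃ (x : γ.HalfEdge) (e : γ'.HalfEdge → γ.HalfEdge),
    γ.vert x = v ∧ γ.vert (γ.opp x) = v ∧ γ.IsContraction γ' x e ∧
      ∀ y, γ.vert (e y) = f (γ'.vert y)

end CellGraph

/-- A two-colored cell graph of type `(g, n, m)`: a connected ribbon graph of genus `g` with `n ≥ 1`
red vertices (inputs), labeled by `Fin n`, and `m ≥ 0` blue vertices (outputs), labeled by
`Fin m`. -/
structure ColoredCellGraph (g n m : ℕ) extends CellGraph (Fin n ⊕ Fin m) where
  pos : 0 < n
  connected : toCellGraph.Connected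
  /-- Euler's formula `V - E + F = 2 - 2g`. -/
  euler : n + m + toCellGraph.numFaces + 2 * g = toCellGraph.numEdges + 2

/-! ### Vertex maps of the contractions -/

namespace VertexMap

/-- `0, 1 ↦ 0` and `i + 2 ↦ i + 1`. -/
def merge (n : ℕ) : Fin (n + 2) → Fin (n + 1) := Fin.cases 0 id

/-- Red `0` and blue `0` become red `0`. -/
def mixedToRed (n m : ℕ) : Fin (n + 1) ⊕ Fin (m + 1) → Fin (n + 1) ⊕ Fin m :=
  Sum.elim Sum.inl (Fin.cases (Sum.inl 0) Sum.inr)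

/-- Red `0` and blue `0` become blue `0`. -/
def mixedToBlue (n m : ℕ) : Fin (n + 1) ⊕ Fin (m + 1) → Fin n ⊕ Fin (m + 1) :=
  Sum.elim (Fin.cases (Sum.inr 0) Sum.inl) Sum.inr

/-- The concatenation of two lists of labels. -/
def concat (n₁ n₂ : ℕ) : Fin n₁ ⊕ Fin n₂ → Fin (n₁ + n₂) :=
  Sum.elim (Fin.castAdd n₂) (Fin.natAdd n₁)

/-- The concatenation of two lists of labels whose first entries are identified. -/
def concatHead (n₁ n₂ : ℕ) : Fin (n₁ + 1) ⊕ Fin (n₂ + 1) → Fin (n₁ + n₂ + 1) :=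
  Sum.elim (Fin.cases 0 fun i => (Fin.castAdd n₂ i).succ)
    (Fin.cases 0 fun i => (Fin.natAdd n₁ i).succ)

/-- The vertices of two colored graphs, when the first red vertices of both are identified. -/
def joinRed (n₁ m₁ n₂ m₂ : ℕ) (v : (Fin (n₁ + 1) ⊕ Fin m₁) ⊕ (Fin (n₂ + 1) ⊕ Fin m₂)) :
    Fin (n₁ + n₂ + 1) ⊕ Fin (m₁ + m₂) :=
  Sum.map (concatHead n₁ n₂) (concat m₁ m₂) (Equiv.sumSumSumComm _ _ _ _ v)

/-- The vertices of two colored graphs, when the first blue vertices of both are identified. -/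
def joinBlue (n₁ m₁ n₂ m₂ : ℕ) (v : (Fin n₁ ⊕ Fin (m₁ + 1)) ⊕ (Fin n₂ ⊕ Fin (m₂ + 1))) :
    Fin (n₁ + n₂) ⊕ Fin (m₁ + m₂ + 1) :=
  Sum.map (concat n₁ n₂) (concatHead m₁ m₂) (Equiv.sumSumSumComm _ _ _ _ v)

end VertexMap

/-! ### The edge contraction/construction axioms -/

/-- An assignment of a linear map `Ω(γ) : A^{⊗n} → A^{⊗m}` to every two-colored cell graph `γ` of
type `(g, n, m)`. -/
def RibbonMaps (K A : Type*) [Field K] [AddCommGroup A] [Module K A] : Type _ :=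
  ∀ g n m : ℕ, ColoredCellGraph g n m → (⨂[K]^n A →ₗ[K] ⨂[K]^m A)

/-- The edge contraction/construction axioms for two-colored cell graphs, with values in the
counital nearly Frobenius algebra `A`. The vertices involved are always the first ones of their
color; by `symmetry` this is no restriction. -/
structure IsRibbonTQFT {K A : Type*} [Field K] [NonUnitalRing A] [Module K A]
    [IsScalarTower K A A] [SMulCommClass K A A] [Coalgebra K A] (Ω : RibbonMaps K A) :
    Prop where
  /-- The graph with a single red vertex and no edges. -/
  base : ∀ γ : ColoredCellGraph 0 1 0, IsEmpty γ.HalfEdge → Ω 0 1 0 γ = TensorOps.counitOne K A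
  /-- Invariance under isomorphisms of graphs and equivariance under relabelings of vertices. -/
  symmetry : ∀ (g n m : ℕ) (γ γ' : ColoredCellGraph g n m) (σ : Equiv.Perm (Fin n))
    (τ : Equiv.Perm (Fin m)) (e : γ.HalfEdge ≃ γ'.HalfEdge),
    γ.IsIso γ'.toCellGraph (Equiv.sumCongr σ τ) e → ∀ v : ⨂[K]^n A,
    Ω g n m γ' (PiTensorProduct.reindex K (fun _ => A) σ v) =
      PiTensorProduct.reindex K (fun _ => A) τ (Ω g n m γ v)
  /-- An edge joining two red vertices: the two inputs are multiplied. -/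
  red_edge : ∀ (g n m : ℕ) (γ : ColoredCellGraph g (n + 2) m) (γ' : ColoredCellGraph g (n + 1) m),
    γ.EdgeContraction γ'.toCellGraph (Sum.inl 0) (Sum.inl 1) (Sum.map (VertexMap.merge n) id) →
    Ω _ _ _ γ = Ω _ _ _ γ' ∘ₗ TensorOps.mulHead K A n
  /-- An edge joining two blue vertices: the two outputs are constructed from one by `δ`. -/
  blue_edge : ∀ (g n m : ℕ) (γ : ColoredCellGraph g n (m + 2)) (γ' : ColoredCellGraph g n (m + 1)),
    γ.EdgeContraction γ'.toCellGraph (Sum.inr 0) (Sum.inr 1) (Sum.map id (VertexMap.merge m)) →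
    Ω _ _ _ γ = TensorOps.comulHead K A m ∘ₗ Ω _ _ _ γ'
  /-- An edge joining a red and a blue vertex, contracted to a red vertex: `δ` is applied to the
  input, and one of the two factors becomes the output. -/
  mixed_edge_red : ∀ (g n m : ℕ) (γ : ColoredCellGraph g (n + 1) (m + 1))
    (γ' : ColoredCellGraph g (n + 1) m),
    γ.EdgeContraction γ'.toCellGraph (Sum.inl 0) (Sum.inr 0) (VertexMap.mixedToRed n m) →
    Ω _ _ _ γ = TensorOps.idTensor (Ω _ _ _ γ') ∘ₗ TensorOps.comulHead K A n
  /-- An edge joining a red and a blue vertex, contracted to a blue vertex: the output is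
  multiplied by the input. -/
  mixed_edge_blue : ∀ (g n m : ℕ) (γ : ColoredCellGraph g (n + 1) (m + 1))
    (γ' : ColoredCellGraph g n (m + 1)),
    γ.EdgeContraction γ'.toCellGraph (Sum.inl 0) (Sum.inr 0) (VertexMap.mixedToBlue n m) →
    Ω _ _ _ γ = TensorOps.mulHead K A m ∘ₗ TensorOps.idTensor (Ω _ _ _ γ')
  /-- A loop at a red vertex whose contraction leaves the graph connected. -/
  red_handle : ∀ (g n m : ℕ) (γ : ColoredCellGraph (g + 1) (n + 1) m)
    (γ' : ColoredCellGraph g (n + 2) m),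
    γ.LoopContraction γ'.toCellGraph (Sum.inl 0) (Sum.map (VertexMap.merge n) id) →
    Ω _ _ _ γ = Ω _ _ _ γ' ∘ₗ TensorOps.comulHead K A n
  /-- A loop at a red vertex whose contraction disconnects the graph. -/
  red_separating : ∀ (g₁ n₁ m₁ g₂ n₂ m₂ : ℕ)
    (γ : ColoredCellGraph (g₁ + g₂) (n₁ + n₂ + 1) (m₁ + m₂))
    (γ₁ : ColoredCellGraph g₁ (n₁ + 1) m₁) (γ₂ : ColoredCellGraph g₂ (n₂ + 1) m₂),
    γ.LoopContraction (γ₁.disjUnion γ₂.toCellGraph) (Sum.inl 0)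
      (VertexMap.joinRed n₁ m₁ n₂ m₂) →
    Ω _ _ _ γ = TensorPower.mulEquiv.toLinearMap ∘ₗ
      TensorProduct.map (Ω _ _ _ γ₁) (Ω _ _ _ γ₂) ∘ₗ TensorOps.comulPair K A n₁ n₂
  /-- A loop at a blue vertex whose contraction leaves the graph connected. -/
  blue_handle : ∀ (g n m : ℕ) (γ : ColoredCellGraph (g + 1) n (m + 1))
    (γ' : ColoredCellGraph g n (m + 2)),
    γ.LoopContraction γ'.toCellGraph (Sum.inr 0) (Sum.map id (VertexMap.merge m)) →
    Ω _ _ _ γ = TensorOps.mulHead K A m ∘ₗ Ω _ _ _ γ'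
  /-- A loop at a blue vertex whose contraction disconnects the graph into two components that
  both have red vertices. -/
  blue_separating : ∀ (g₁ n₁ m₁ g₂ n₂ m₂ : ℕ)
    (γ : ColoredCellGraph (g₁ + g₂) (n₁ + n₂) (m₁ + m₂ + 1))
    (γ₁ : ColoredCellGraph g₁ n₁ (m₁ + 1)) (γ₂ : ColoredCellGraph g₂ n₂ (m₂ + 1)),
    γ.LoopContraction (γ₁.disjUnion γ₂.toCellGraph) (Sum.inr 0)
      (VertexMap.joinBlue n₁ m₁ n₂ m₂) →
    Ω _ _ _ γ = TensorOps.mulPair K A m₁ m₂ ∘ₗ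
      TensorProduct.map (Ω _ _ _ γ₁) (Ω _ _ _ γ₂) ∘ₗ TensorPower.mulEquiv.symm.toLinearMap

/-- The assignment `Ω(γ) = ω_{g,n,m}` for `γ` of type `(g, n, m)`. -/
def CobordismMaps.toRibbon {K A : Type*} [Field K] [AddCommGroup A] [Module K A]
    (ω : CobordismMaps K A) : RibbonMaps K A :=
  fun g n m γ => ω g n m γ.pos

set_option linter.unusedSectionVars false

/-! ### Tensor powers and permutations of their factors -/

namespace TensorOps

section LinearPart

variable {K A : Type*} [Field K] [AddCommGroup A] [Module K A]

/-! Both systems of axioms are rigid: each forces `A` to be commutative and cocommutative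
(`IsBicommutative`), and each leaves only one possible value on a surface of type (g, n, m), namely
`surfaceMap`: multiply all inputs, apply the handle operator m ∘ δ g times, comultiply to m outputs.
Conversely, over a bicommutative nearly Frobenius algebra these maps satisfy both systems
(`isAlmostTQFT_surfaceMaps`, `isRibbonTQFT_surfaceMaps`). The equivalence follows once
`CobordismMaps.toRibbon_injective` is known, which needs a graph of every type.

Verification of the axioms is algebra. The Frobenius relation makes δ a bimodule map, so
multiplications and handles slide through δ, and splitting into k + 1 factors and multiplying them
again produces k handles (`prod_comulPow`). As `A` may lack a unit, products that may be empty are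
taken in the unitization.

Rigidity of an Almost TQFT: every connected surface with an input is sewn from cylinders, disks and
pairs of pants, and `surfaceMap` obeys the same sewing rules (`IsAlmostTQFT.eq_surfaceMaps`).

Rigidity of a ribbon TQFT (`IsRibbonTQFT.determinedAt`) is an induction on the number of half-edges.
If there is a second vertex, an edge from the first red vertex to another vertex is contracted.
Otherwise a loop with the fewest steps between its halves is contracted: either the graph stays
connected or a bare point splits off. The face permutation of a contracted graph is the first return
map of the old one, so the number of faces is controlled, and the existence of an integral genus
comes out of the same induction. Bicommutativity comes from the automorphism of a star with two
leaves that exchanges the leaves (`IsRibbonTQFT.isBicommutative`). -/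

theorem uncons_cons {n : ℕ} (x : A ⊗[K] ⨂[K]^n A) : uncons K A n (cons K A n x) = x := by
  suffices uncons K A n ∘ₗ cons K A n = LinearMap.id from LinearMap.congr_fun this x
  refine TensorProduct.ext' fun a t => ?_
  induction t using PiTensorProduct.induction_on with
  | smul_tprod r v => simp [cons_tprod, uncons_tprod, TensorProduct.tmul_smul]
  | add x y hx hy => rw [TensorProduct.tmul_add, map_add, map_add, hx, hy]

theorem cons_uncons {n : ℕ} (t : ⨂[K]^(n + 1) A) : cons K A n (uncons K A n t) = t := by
  induction t using PiTensorProduct.induction_on with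
  | smul_tprod r v => simp [cons_tprod, uncons_tprod]
  | add x y hx hy => rw [map_add, map_add, hx, hy]

/-- Two linear maps on `A^{⊗(n+1)}` agree if they agree on all `a ⊗ t`. -/
theorem hom_ext_cons {n : ℕ} {E : Type*} [AddCommGroup E] [Module K E]
    {f g : ⨂[K]^(n + 1) A →ₗ[K] E}
    (h : ∀ a t, f (cons K A n (a ⊗ₜ t)) = g (cons K A n (a ⊗ₜ t))) : f = g := by
  have : f ∘ₗ cons K A n = g ∘ₗ cons K A n := TensorProduct.ext' h
  ext1
  ext v
  simpa [cons_tprod] using LinearMap.congr_fun this (v 0 ⊗ₜ PiTensorProduct.tprod K (Fin.tail v))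

theorem idTensor_cons {n m : ℕ} (F : ⨂[K]^n A →ₗ[K] ⨂[K]^m A) (x : A ⊗[K] ⨂[K]^n A) :
    idTensor F (cons K A n x) = cons K A m (F.lTensor A x) := by
  simp [idTensor, uncons_cons]

theorem mulEquiv_tprod {n m : ℕ} (v : Fin n → A) (w : Fin m → A) :
    TensorPower.mulEquiv (PiTensorProduct.tprod K v ⊗ₜ[K] PiTensorProduct.tprod K w) =
      PiTensorProduct.tprod K (Fin.append v w) :=
  TensorPower.tprod_mul_tprod K v w

/-- The identification of `A^{⊗n}` and `A^{⊗m}` for `n = m`. -/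
noncomputable def castEquiv (K A : Type*) [Field K] [AddCommGroup A] [Module K A] {n m : ℕ}
    (h : n = m) : ⨂[K]^n A ≃ₗ[K] ⨂[K]^m A :=
  PiTensorProduct.reindex K (fun _ => A) (finCongr h)

theorem castEquiv_tprod {n m : ℕ} (h : n = m) (v : Fin n → A) :
    castEquiv K A h (PiTensorProduct.tprod K v) =
      PiTensorProduct.tprod K (v ∘ Fin.cast h.symm) :=
  PiTensorProduct.reindex_tprod _ _

@[simp]
theorem castEquiv_rfl {n : ℕ} (t : ⨂[K]^n A) : castEquiv K A rfl t = t := by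
  induction t using PiTensorProduct.induction_on with
  | smul_tprod r v => rw [map_smul, castEquiv_tprod]; rfl
  | add x y hx hy => rw [map_add, hx, hy]

/-- Associativity of concatenation; the cast is there because n + 1 + m and n + m + 1 are not
definitionally equal. -/
theorem mulEquiv_cons {n m : ℕ} (a : A) (s : ⨂[K]^n A) (t : ⨂[K]^m A) :
    TensorPower.mulEquiv (cons K A n (a ⊗ₜ s) ⊗ₜ[K] t) =
      castEquiv K A (Nat.add_right_comm n m 1)
        (cons K A (n + m) (a ⊗ₜ TensorPower.mulEquiv (s ⊗ₜ[K] t))) := by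
  induction s using PiTensorProduct.induction_on with
  | smul_tprod r v =>
    induction t using PiTensorProduct.induction_on with
    | smul_tprod q w =>
      simp only [TensorProduct.tmul_smul, ← TensorProduct.smul_tmul', map_smul, mulEquiv_tprod,
        cons_tprod, castEquiv_tprod]
      congr 3
      exact Fin.append_cons a v w
    | add x y hx hy => simp only [TensorProduct.tmul_add, map_add, hx, hy]
  | add x y hx hy => simp only [TensorProduct.tmul_add, TensorProduct.add_tmul, map_add, hx, hy]

theorem mulEquiv_zero {m : ℕ} (t : ⨂[K]^m A) :
    TensorPower.mulEquiv (PiTensorProduct.tprod K (Fin.elim0 : Fin 0 → A) ⊗ₜ[K] t) =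
      castEquiv K A (Nat.zero_add m).symm t := by
  induction t using PiTensorProduct.induction_on with
  | smul_tprod r v =>
    simp only [TensorProduct.tmul_smul, map_smul, mulEquiv_tprod, castEquiv_tprod]
    congr 2
    exact Fin.elim0_append v
  | add x y hx hy => simp only [TensorProduct.tmul_add, map_add, hx, hy]

/-- Together with `reindex_swap_cons_cons` this reaches all adjacent transpositions, hence all
permutations. -/
theorem reindex_succ_cons {n : ℕ} (i j : Fin n) (a : A) (t : ⨂[K]^n A) :
    PiTensorProduct.reindex K (fun _ => A) (Equiv.swap i.succ j.succ) (cons K A n (a ⊗ₜ t)) =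
      cons K A n (a ⊗ₜ PiTensorProduct.reindex K (fun _ => A) (Equiv.swap i j) t) := by
  induction t using PiTensorProduct.induction_on with
  | smul_tprod r v =>
    simp only [TensorProduct.tmul_smul, map_smul, cons_tprod, PiTensorProduct.reindex_tprod]
    congr 2
    ext k
    refine Fin.cases ?_ (fun k => ?_) k
    · rw [Equiv.symm_swap, Equiv.swap_apply_of_ne_of_ne (Fin.succ_ne_zero i).symm
        (Fin.succ_ne_zero j).symm]
      rfl
    · rw [Equiv.symm_swap, Equiv.symm_swap, ← (Fin.succ_injective n).map_swap]
      rfl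
  | add x y hx hy => simp only [TensorProduct.tmul_add, map_add, hx, hy]

theorem reindex_swap_cons_cons {n : ℕ} (a b : A) (t : ⨂[K]^n A) :
    PiTensorProduct.reindex K (fun _ => A) (Equiv.swap (0 : Fin (n + 2)) 1)
        (cons K A (n + 1) (a ⊗ₜ cons K A n (b ⊗ₜ t))) =
      cons K A (n + 1) (b ⊗ₜ cons K A n (a ⊗ₜ t)) := by
  induction t using PiTensorProduct.induction_on with
  | smul_tprod r v =>
    simp only [TensorProduct.tmul_smul, map_smul, cons_tprod, PiTensorProduct.reindex_tprod]
    congr 2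
    ext k
    refine Fin.cases ?_ (fun k => Fin.cases ?_ (fun k => ?_) k) k
    · simp
    · simp
    · rw [Equiv.symm_swap, Equiv.swap_apply_of_ne_of_ne (Fin.succ_ne_zero _)
        (by simp [Fin.ext_iff])]
      rfl
  | add x y hx hy => simp only [TensorProduct.tmul_add, map_add, hx, hy]

theorem reindex_mul {n : ℕ} (σ τ : Equiv.Perm (Fin n)) (t : ⨂[K]^n A) :
    PiTensorProduct.reindex K (fun _ => A) (σ * τ) t =
      PiTensorProduct.reindex K (fun _ => A) σ (PiTensorProduct.reindex K (fun _ => A) τ t) := by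
  induction t using PiTensorProduct.induction_on with
  | smul_tprod r v => simp only [map_smul, PiTensorProduct.reindex_tprod]; rfl
  | add x y hx hy => simp only [map_add, hx, hy]

theorem reindex_one {n : ℕ} (t : ⨂[K]^n A) :
    PiTensorProduct.reindex K (fun _ => A) (1 : Equiv.Perm (Fin n)) t = t := by
  induction t using PiTensorProduct.induction_on with
  | smul_tprod r v => simp only [map_smul, PiTensorProduct.reindex_tprod]; rfl
  | add x y hx hy => simp only [map_add, hx, hy]

/-- Evaluates a partial composite from any explicit splitting `z` of the output of `F`, so that the
inverse of `TensorPower.mulEquiv` never has to be computed. -/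
theorem partialComp_mulEquiv {n p j k m : ℕ} (F : ⨂[K]^n A →ₗ[K] ⨂[K]^(p + j) A)
    (G : ⨂[K]^(j + k) A →ₗ[K] ⨂[K]^m A) (s : ⨂[K]^n A) (t : ⨂[K]^k A)
    (z : ⨂[K]^p A ⊗[K] ⨂[K]^j A) (hz : F s = TensorPower.mulEquiv z) :
    partialComp F G (TensorPower.mulEquiv (s ⊗ₜ[K] t)) =
      TensorPower.mulEquiv ((G ∘ₗ TensorPower.mulEquiv.toLinearMap).lTensor _
        (TensorProduct.assoc K _ _ _ (z ⊗ₜ[K] t))) := by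
  simp [partialComp, hz]

/-- Two linear maps on `A^{⊗(n+k)}` agree if they agree on all products. -/
theorem hom_ext_mulEquiv {n k : ℕ} {E : Type*} [AddCommGroup E] [Module K E]
    {f g : ⨂[K]^(n + k) A →ₗ[K] E}
    (h : ∀ (s : ⨂[K]^n A) (t : ⨂[K]^k A), f (TensorPower.mulEquiv (s ⊗ₜ t)) =
      g (TensorPower.mulEquiv (s ⊗ₜ t))) : f = g := by
  have : f ∘ₗ TensorPower.mulEquiv.toLinearMap = g ∘ₗ TensorPower.mulEquiv.toLinearMap :=
    TensorProduct.ext' h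
  refine LinearMap.ext fun x => ?_
  obtain ⟨y, rfl⟩ := TensorPower.mulEquiv.surjective x
  exact LinearMap.congr_fun this y

end LinearPart

end TensorOps

open CoalgebraStruct

/-! ### Identities in a nearly Frobenius algebra -/

section Frobenius

variable {K A : Type*} [Field K] [NonUnitalRing A] [Module K A]
    [IsScalarTower K A A] [SMulCommClass K A A] [Coalgebra K A]

namespace IsNearlyFrobenius

/-- The right Frobenius relation on elements: δ is a map of right modules, with `A` acting on the
second factor. -/
theorem comul_mul_right (hA : IsNearlyFrobenius K A) (a b : A) :
    comul (R := K) (a * b) = (LinearMap.mulRight K b).lTensor A (comul (R := K) a) := by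
  have h := LinearMap.congr_fun hA.right_frobenius (a ⊗ₜ[K] b)
  have key : ∀ z : A ⊗[K] A, (LinearMap.mul' K A).lTensor A (TensorProduct.assoc K A A A (z ⊗ₜ b)) =
      (LinearMap.mulRight K b).lTensor A z := fun z => by
    induction z with
    | zero => simp
    | tmul x y => simp
    | add x y hx hy => simp only [TensorProduct.add_tmul, map_add, hx, hy]
  simpa [key] using h.symm

theorem comul_mul_left (hA : IsNearlyFrobenius K A) (a b : A) :
    comul (R := K) (a * b) = (LinearMap.mulLeft K a).rTensor A (comul (R := K) b) := by
  have h := LinearMap.congr_fun hA.left_frobenius (a ⊗ₜ[K] b)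
  have key : ∀ z : A ⊗[K] A, (LinearMap.mul' K A).rTensor A
      ((TensorProduct.assoc K A A A).symm (a ⊗ₜ z)) = (LinearMap.mulLeft K a).rTensor A z :=
    fun z => by
      induction z with
      | zero => simp
      | tmul x y => simp
      | add x y hx hy => simp only [TensorProduct.tmul_add, map_add, hx, hy]
  simpa [key] using h.symm

end IsNearlyFrobenius

/-- The multiplication is commutative and the comultiplication is cocommutative. -/
structure IsBicommutative (K A : Type*) [Field K] [NonUnitalRing A] [Module K A]
    [Coalgebra K A] : Prop where
  mul_comm : ∀ a b : A, a * b = b * a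
  comul_comm : ∀ a : A, TensorProduct.comm K A A (comul a) = comul (R := K) a

namespace TensorOps

theorem mulHead_cons (n : ℕ) (a b : A) (t : ⨂[K]^n A) :
    mulHead K A n (cons K A (n + 1) (a ⊗ₜ cons K A n (b ⊗ₜ t))) = cons K A n ((a * b) ⊗ₜ t) := by
  simp [mulHead, uncons_cons]

theorem comulHead_cons (n : ℕ) (a : A) (t : ⨂[K]^n A) :
    comulHead K A n (cons K A n (a ⊗ₜ t)) = cons K A (n + 1) ((cons K A n).lTensor A
      (TensorProduct.assoc K A A _ (comul (R := K) a ⊗ₜ t))) := by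
  simp [comulHead, uncons_cons]

theorem counitOne_cons (a : A) (t : ⨂[K]^0 A) :
    counitOne K A (cons K A 0 (a ⊗ₜ t)) = counit (R := K) a • t := by
  simp [counitOne, uncons_cons]

theorem mulPair_cons (n₁ n₂ : ℕ) (a b : A) (s : ⨂[K]^n₁ A) (t : ⨂[K]^n₂ A) :
    mulPair K A n₁ n₂ (cons K A n₁ (a ⊗ₜ s) ⊗ₜ cons K A n₂ (b ⊗ₜ t)) =
      cons K A (n₁ + n₂) ((a * b) ⊗ₜ TensorPower.mulEquiv (s ⊗ₜ[K] t)) := by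
  simp [mulPair, uncons_cons]

theorem comulPair_cons (n₁ n₂ : ℕ) (a : A) (s : ⨂[K]^n₁ A) (t : ⨂[K]^n₂ A) :
    comulPair K A n₁ n₂ (cons K A (n₁ + n₂) (a ⊗ₜ TensorPower.mulEquiv (s ⊗ₜ[K] t))) =
      TensorProduct.map (cons K A n₁) (cons K A n₂)
        (TensorProduct.tensorTensorTensorComm K A A (⨂[K]^n₁ A) (⨂[K]^n₂ A)
          (comul (R := K) a ⊗ₜ (s ⊗ₜ t))) := by
  simp [comulPair, uncons_cons]

/-! ### Iterated products -/

/-- The product of the factors in the unitization of `A`. -/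
noncomputable def unitalProd (K A : Type*) [Field K] [NonUnitalRing A] [Module K A]
    [IsScalarTower K A A] [SMulCommClass K A A] (n : ℕ) : ⨂[K]^n A →ₗ[K] Unitization K A :=
  PiTensorProduct.lift ((MultilinearMap.mkPiAlgebraFin K n (Unitization K A)).compLinearMap
    fun _ => Unitization.inrHom K K A)

/-- `v₁ ⊗ ⋯ ⊗ vₙ ↦ v₁ ⋯ vₙ` for `n ≥ 1`. -/
noncomputable def prod (K A : Type*) [Field K] [NonUnitalRing A] [Module K A]
    [IsScalarTower K A A] [SMulCommClass K A A] (n : ℕ) : ⨂[K]^n A →ₗ[K] A :=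
  Unitization.sndHom K K A ∘ₗ unitalProd K A n

/-- Right multiplication by an element of the unitization. -/
noncomputable def rmul (u : Unitization K A) : A →ₗ[K] A :=
  u.fst • LinearMap.id + LinearMap.mulRight K u.snd

theorem inr_rmul (u : Unitization K A) (a : A) :
    (Unitization.inr (rmul u a) : Unitization K A) = Unitization.inr a * u := by
  ext <;> simp [rmul]

theorem comul_rmul (hA : IsNearlyFrobenius K A) (u : Unitization K A) (a : A) :
    comul (R := K) (rmul u a) = (rmul u).lTensor A (comul (R := K) a) := by
  simp [rmul, hA.comul_mul_right, LinearMap.lTensor_add, LinearMap.lTensor_smul]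

/-- Only left multiplication passes to the first factor of δ; commutativity turns right
multiplication into left. -/
theorem comul_rmul' (hA : IsNearlyFrobenius K A) (hc : IsBicommutative K A)
    (u : Unitization K A) (a : A) :
    comul (R := K) (rmul u a) = (rmul u).rTensor A (comul (R := K) a) := by
  have : LinearMap.mulRight K u.snd = LinearMap.mulLeft K u.snd := by
    ext b; simp [hc.mul_comm b]
  simp [rmul, this, hA.comul_mul_left, LinearMap.rTensor_add, LinearMap.rTensor_smul]

theorem unitalProd_tprod {n : ℕ} (v : Fin n → A) :
    unitalProd K A n (PiTensorProduct.tprod K v) =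
      (List.ofFn fun i => (Unitization.inr (v i) : Unitization K A)).prod := by
  simp [unitalProd]

theorem unitalProd_cons {n : ℕ} (a : A) (t : ⨂[K]^n A) :
    unitalProd K A (n + 1) (cons K A n (a ⊗ₜ t)) = Unitization.inr a * unitalProd K A n t := by
  induction t using PiTensorProduct.induction_on with
  | smul_tprod r v =>
    simp only [TensorProduct.tmul_smul, map_smul, cons_tprod, unitalProd_tprod, mul_smul_comm]
    simp [List.ofFn_succ]
  | add x y hx hy => simp only [TensorProduct.tmul_add, map_add, hx, hy, mul_add]

theorem unitalProd_mulEquiv {n k : ℕ} (s : ⨂[K]^n A) (t : ⨂[K]^k A) :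
    unitalProd K A (n + k) (TensorPower.mulEquiv (s ⊗ₜ[K] t)) =
      unitalProd K A n s * unitalProd K A k t := by
  induction s using PiTensorProduct.induction_on with
  | smul_tprod r v =>
    induction t using PiTensorProduct.induction_on with
    | smul_tprod q w =>
      simp only [TensorProduct.tmul_smul, ← TensorProduct.smul_tmul', map_smul, mulEquiv_tprod,
        unitalProd_tprod, mul_smul_comm, smul_mul_assoc]
      congr 2
      have h := List.ofFn_fin_append (fun i => (Unitization.inr (v i) : Unitization K A))
        (fun i => (Unitization.inr (w i) : Unitization K A))
      rw [← List.prod_append, ← h]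
      congr 2
      ext1 i
      refine Fin.addCases (fun i => ?_) (fun i => ?_) i <;> simp
    | add x y hx hy => simp only [TensorProduct.tmul_add, map_add, hx, hy, mul_add]
  | add x y hx hy => simp only [TensorProduct.add_tmul, map_add, hx, hy, add_mul]

/-- The tail may be empty, so its product is kept in the unitization and acts on `a` through `rmul`.
-/
theorem prod_cons {n : ℕ} (a : A) (t : ⨂[K]^n A) :
    prod K A (n + 1) (cons K A n (a ⊗ₜ t)) = rmul (unitalProd K A n t) a := by
  apply Unitization.inr_injective (R := K)
  rw [inr_rmul, ← unitalProd_cons]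
  ext
  · simp [unitalProd_cons]
  · rfl

/-- A product with at least one factor has no scalar part. This fails for n = 0, where `unitalProd`
of the empty tensor is 1 and `prod` is 0. -/
theorem inr_prod {n : ℕ} (hn : 0 < n) (t : ⨂[K]^n A) :
    (Unitization.inr (prod K A n t) : Unitization K A) = unitalProd K A n t := by
  obtain ⟨n, rfl⟩ := Nat.exists_eq_succ_of_ne_zero hn.ne'
  refine LinearMap.congr_fun (f := Unitization.inrHom K K A ∘ₗ prod K A (n + 1))
    (g := unitalProd K A (n + 1)) (hom_ext_cons fun a t => ?_) t
  simp [prod_cons, inr_rmul, unitalProd_cons]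

theorem prod_mulEquiv {n k : ℕ} (hn : 0 < n) (s : ⨂[K]^n A) (t : ⨂[K]^k A) :
    prod K A (n + k) (TensorPower.mulEquiv (s ⊗ₜ[K] t)) =
      rmul (unitalProd K A k t) (prod K A n s) := by
  apply Unitization.inr_injective (R := K)
  rw [inr_prod (Nat.add_pos_left hn k), inr_rmul, inr_prod hn, unitalProd_mulEquiv]

theorem rmul_unitalProd {n : ℕ} (hn : 0 < n) (t : ⨂[K]^n A) (a : A) :
    rmul (unitalProd K A n t) a = a * prod K A n t := by
  apply Unitization.inr_injective (R := K)
  rw [inr_rmul, ← inr_prod hn, Unitization.inr_mul]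

theorem prod_mulHead {n : ℕ} (t : ⨂[K]^(n + 2) A) :
    prod K A (n + 1) (mulHead K A n t) = prod K A (n + 2) t := by
  refine LinearMap.congr_fun (f := prod K A (n + 1) ∘ₗ mulHead K A n)
    (g := prod K A (n + 2)) (hom_ext_cons fun a t => ?_) t
  rw [← cons_uncons t]
  induction uncons K A n t with
  | zero => simp
  | tmul b t =>
    rw [LinearMap.comp_apply, mulHead_cons, prod_cons, prod_cons]
    apply Unitization.inr_injective (R := K)
    rw [inr_rmul, inr_rmul, unitalProd_cons, Unitization.inr_mul, mul_assoc]
  | add x y hx hy => simp only [map_add, TensorProduct.tmul_add, hx, hy]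

theorem unitalProd_reindex (hc : IsBicommutative K A) {n : ℕ} (σ : Equiv.Perm (Fin n))
    (t : ⨂[K]^n A) :
    unitalProd K A n (PiTensorProduct.reindex K (fun _ => A) σ t) = unitalProd K A n t := by
  -- With this instance the unitization is a commutative ring, so the ordered product becomes a
  -- `Finset` product, which ignores the order.
  let _ : NonUnitalCommRing A := { ‹NonUnitalRing A› with mul_comm := hc.mul_comm }
  have key : ∀ v : Fin n → A, unitalProd K A n (PiTensorProduct.tprod K v) =
      ∏ i, (Unitization.inr (v i) : Unitization K A) := fun v => by
    rw [unitalProd_tprod]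
    exact List.prod_ofFn
  induction t using PiTensorProduct.induction_on with
  | smul_tprod r v =>
    rw [map_smul, map_smul, map_smul, PiTensorProduct.reindex_tprod, key, key]
    congr 1
    exact Equiv.prod_comp σ.symm fun i => (Unitization.inr (v i) : Unitization K A)
  | add x y hx hy => rw [map_add, map_add, map_add, hx, hy]

theorem prod_reindex (hc : IsBicommutative K A) {n : ℕ} (σ : Equiv.Perm (Fin n))
    (t : ⨂[K]^n A) :
    prod K A n (PiTensorProduct.reindex K (fun _ => A) σ t) = prod K A n t :=
  congrArg (Unitization.sndHom K K A) (unitalProd_reindex hc σ t)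

/-! ### Iterated coproducts -/

/-- The iterated coproduct `A → A^{⊗m}`, which is the counit for `m = 0`. -/
noncomputable def comulPow (K A : Type*) [Field K] [NonUnitalRing A] [Module K A]
    [Coalgebra K A] : ∀ m : ℕ, A →ₗ[K] ⨂[K]^m A
  | 0 => (counit (R := K) (A := A)).smulRight (PiTensorProduct.tprod K Fin.elim0)
  | m + 1 => cons K A m ∘ₗ (comulPow K A m).lTensor A ∘ₗ comul

theorem comulPow_succ (m : ℕ) (a : A) : comulPow K A (m + 1) a =
    cons K A m ((comulPow K A m).lTensor A (comul (R := K) a)) := rfl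

/-- The recursion ends in (id ⊗ ε) ∘ δ, which is the identity by the counit axiom. -/
theorem comulPow_one (a : A) :
    comulPow K A 1 a = cons K A 0 (a ⊗ₜ PiTensorProduct.tprod K Fin.elim0) := by
  rw [comulPow_succ]
  congr 1
  have key : ∀ z : A ⊗[K] A, (comulPow K A 0).lTensor A z =
      (TensorProduct.rid K A ((counit (R := K) (A := A)).lTensor A z)) ⊗ₜ
        PiTensorProduct.tprod K Fin.elim0 := fun z => by
    induction z with
    | zero => simp
    | tmul x y => simp [comulPow, TensorProduct.tmul_smul, TensorProduct.smul_tmul']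
    | add x y hx hy => simp only [map_add, hx, hy, TensorProduct.add_tmul]
  rw [key]
  simp

theorem castEquiv_comulPow {p q : ℕ} (h : p = q) (a : A) :
    castEquiv K A h (comulPow K A p a) = comulPow K A q a := by
  subst h; simp

/-- General coassociativity, by induction on p: the counit axiom starts it and one application of
coassociativity continues it. Outputs can thus be grouped freely before sewing. -/
theorem comulPow_add (p q : ℕ) (a : A) :
    TensorPower.mulEquiv (TensorProduct.map (comulPow K A p) (comulPow K A q)
      (comul (R := K) a)) = comulPow K A (p + q) a := by
  induction p generalizing a with
  | zero =>
    have key : ∀ z : A ⊗[K] A,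
        TensorPower.mulEquiv (TensorProduct.map (comulPow K A 0) (comulPow K A q) z) =
        castEquiv K A (Nat.zero_add q).symm (comulPow K A q (TensorProduct.lid K A
          ((counit (R := K) (A := A)).rTensor A z))) := fun z => by
      induction z with
      | zero => simp
      | tmul x y =>
        simp [comulPow, ← TensorProduct.smul_tmul', mulEquiv_zero]
      | add x y hx hy => simp only [map_add, hx, hy]
    rw [key]
    simp [castEquiv_comulPow]
  | succ p ih =>
    have key : ∀ z : A ⊗[K] A,
        TensorPower.mulEquiv (TensorProduct.map (comulPow K A (p + 1)) (comulPow K A q) z) =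
        castEquiv K A (Nat.add_right_comm p q 1) (cons K A (p + q)
          ((TensorPower.mulEquiv.toLinearMap ∘ₗ
            TensorProduct.map (comulPow K A p) (comulPow K A q)).lTensor A
            (TensorProduct.assoc K A A A ((comul (R := K) (A := A)).rTensor A z)))) := fun z => by
      induction z with
      | zero => simp
      | tmul x y =>
        rw [TensorProduct.map_tmul, LinearMap.rTensor_tmul, comulPow_succ]
        induction comul (R := K) x with
        | zero => simp
        | tmul b c => simp [mulEquiv_cons]
        | add x y hx hy => simp only [map_add, hx, hy, TensorProduct.add_tmul]
      | add x y hx hy => simp only [map_add, hx, hy]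
    rw [key, Coalgebra.coassoc_apply, ← LinearMap.comp_apply (LinearMap.lTensor _ _),
      ← LinearMap.lTensor_comp]
    have : (TensorPower.mulEquiv.toLinearMap ∘ₗ
        TensorProduct.map (comulPow K A p) (comulPow K A q)) ∘ₗ comul =
        comulPow K A (p + q) := LinearMap.ext ih
    rw [this, ← comulPow_succ, castEquiv_comulPow]

/-- The recursion applies δ to the second factor; coassociativity moves it to the first. -/
theorem comulHead_comulPow (m : ℕ) (a : A) :
    comulHead K A m (comulPow K A (m + 1) a) = comulPow K A (m + 2) a := by
  have key : ∀ z : A ⊗[K] A, comulHead K A m (cons K A m ((comulPow K A m).lTensor A z)) =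
      cons K A (m + 1) ((cons K A m ∘ₗ (comulPow K A m).lTensor A).lTensor A
        (TensorProduct.assoc K A A A ((comul (R := K) (A := A)).rTensor A z))) := fun z => by
    induction z with
    | zero => simp
    | tmul x y =>
      rw [LinearMap.lTensor_tmul, comulHead_cons, LinearMap.rTensor_tmul]
      induction comul (R := K) x with
      | zero => simp
      | tmul b c => simp
      | add x y hx hy => simp only [map_add, hx, hy, TensorProduct.add_tmul]
    | add x y hx hy => simp only [map_add, hx, hy]
  rw [comulPow_succ, key, Coalgebra.coassoc_apply, ← LinearMap.comp_apply (LinearMap.lTensor _ _),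
    ← LinearMap.lTensor_comp]
  rfl

theorem reindex_comulHead (hc : IsBicommutative K A) (m : ℕ) (t : ⨂[K]^(m + 1) A) :
    PiTensorProduct.reindex K (fun _ => A) (Equiv.swap (0 : Fin (m + 2)) 1)
      (comulHead K A m t) = comulHead K A m t := by
  have key : ∀ (z : A ⊗[K] A) (t : ⨂[K]^m A),
      PiTensorProduct.reindex K (fun _ => A) (Equiv.swap (0 : Fin (m + 2)) 1)
        (cons K A (m + 1) ((cons K A m).lTensor A (TensorProduct.assoc K A A _ (z ⊗ₜ t)))) =
      cons K A (m + 1) ((cons K A m).lTensor A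
        (TensorProduct.assoc K A A _ (TensorProduct.comm K A A z ⊗ₜ t))) := fun z t => by
    induction z with
    | zero => simp
    | tmul x y => simp [reindex_swap_cons_cons]
    | add x y hx hy => simp only [map_add, hx, hy, TensorProduct.add_tmul]
  refine LinearMap.congr_fun (f := (PiTensorProduct.reindex K (fun _ => A)
    (Equiv.swap (0 : Fin (m + 2)) 1)).toLinearMap ∘ₗ comulHead K A m)
    (g := comulHead K A m) (hom_ext_cons fun a t => ?_) t
  simp only [LinearMap.comp_apply, LinearEquiv.coe_coe, comulHead_cons, key, hc.comul_comm]

/-- Adjacent transpositions generate. The one of positions 0 and 1 is absorbed by a δ in front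
(`comulHead_comulPow` and cocommutativity); the others act on the tail, where induction applies. -/
theorem reindex_comulPow (hc : IsBicommutative K A) {m : ℕ} (τ : Equiv.Perm (Fin m)) (a : A) :
    PiTensorProduct.reindex K (fun _ => A) τ (comulPow K A m a) = comulPow K A m a := by
  induction m generalizing a with
  | zero => rw [Subsingleton.elim τ 1, reindex_one]
  | succ m ih =>
    have hτ : τ ∈ Submonoid.closure
        (Set.range fun i : Fin m => Equiv.swap i.castSucc i.succ) := by
      rw [Equiv.Perm.mclosure_swap_castSucc_succ]; trivial
    induction hτ using Submonoid.closure_induction with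
    | one => rw [reindex_one]
    | mul σ τ _ _ hσ hτ => rw [reindex_mul, hτ, hσ]
    | mem σ hσ =>
      obtain ⟨i, rfl⟩ := hσ
      cases m with
      | zero => exact i.elim0
      | succ m =>
        refine Fin.cases ?_ (fun i => ?_) i
        · rw [← comulHead_comulPow]
          exact reindex_comulHead hc m _
        · have key : ∀ z : A ⊗[K] A, PiTensorProduct.reindex K (fun _ => A)
              (Equiv.swap i.succ.castSucc i.succ.succ)
              (cons K A (m + 1) ((comulPow K A (m + 1)).lTensor A z)) =
              cons K A (m + 1) ((comulPow K A (m + 1)).lTensor A z) := fun z => by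
            induction z with
            | zero => simp
            | tmul x y =>
              rw [LinearMap.lTensor_tmul, Fin.castSucc_succ, reindex_succ_cons, ih]
            | add x y hx hy => simp only [map_add, hx, hy]
          exact key _

/-! ### The handle operator -/

/-- `a ↦ m(δ(a))`. -/
noncomputable def handle (K A : Type*) [Field K] [NonUnitalRing A] [Module K A]
    [IsScalarTower K A A] [SMulCommClass K A A] [Coalgebra K A] : Module.End K A :=
  LinearMap.mul' K A ∘ₗ comul

/-- m and δ are both maps of left modules; `handle_rmul` is the right-handed version. Handles
therefore commute with multiplication by other inputs. -/
theorem handle_mul (hA : IsNearlyFrobenius K A) (a b : A) :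
    handle K A (a * b) = a * handle K A b := by
  simp only [handle, LinearMap.comp_apply, hA.comul_mul_left]
  induction comul (R := K) b with
  | zero => simp
  | tmul x y => simp [mul_assoc]
  | add x y hx hy => simp only [map_add, hx, hy, mul_add]

theorem handle_rmul (hA : IsNearlyFrobenius K A) (u : Unitization K A) (a : A) :
    handle K A (rmul u a) = rmul u (handle K A a) := by
  simp only [handle, LinearMap.comp_apply, comul_rmul hA]
  induction comul (R := K) a with
  | zero => simp
  | tmul x y => simp [rmul, mul_assoc]
  | add x y hx hy => simp only [map_add, hx, hy]

theorem handle_pow_rmul (hA : IsNearlyFrobenius K A) (g : ℕ) (u : Unitization K A) (a : A) :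
    (handle K A ^ g) (rmul u a) = rmul u ((handle K A ^ g) a) := by
  induction g with
  | zero => rfl
  | succ g ih => rw [pow_succ', Module.End.mul_apply, ih, handle_rmul hA]; rfl

theorem handle_pow_mul (hA : IsNearlyFrobenius K A) (g : ℕ) (a b : A) :
    (handle K A ^ g) (a * b) = a * (handle K A ^ g) b := by
  induction g with
  | zero => rfl
  | succ g ih => rw [pow_succ', Module.End.mul_apply, ih, handle_mul hA]; rfl

/-- The Frobenius relation evaluated at δ(a), combined with coassociativity: a handle can be moved
from the input of δ to its second output, and in `comul_handle'` to the first. -/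
theorem comul_handle (hA : IsNearlyFrobenius K A) (a : A) :
    comul (R := K) (handle K A a) = (handle K A).lTensor A (comul (R := K) a) := by
  have h := LinearMap.congr_fun hA.right_frobenius (comul a)
  simp only [LinearMap.comp_apply, LinearEquiv.coe_coe, Coalgebra.coassoc_apply] at h
  rw [← LinearMap.comp_apply (LinearMap.lTensor _ _), ← LinearMap.lTensor_comp] at h
  exact h.symm

theorem comul_handle' (hA : IsNearlyFrobenius K A) (a : A) :
    comul (R := K) (handle K A a) = (handle K A).rTensor A (comul (R := K) a) := by
  have h := LinearMap.congr_fun hA.left_frobenius (comul a)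
  simp only [LinearMap.comp_apply, LinearEquiv.coe_coe, Coalgebra.coassoc_symm_apply] at h
  rw [← LinearMap.comp_apply (LinearMap.rTensor _ _), ← LinearMap.rTensor_comp] at h
  exact h.symm

theorem comul_handle_pow (hA : IsNearlyFrobenius K A) (g : ℕ) (a : A) :
    comul (R := K) ((handle K A ^ g) a) =
      (handle K A ^ g).lTensor A (comul (R := K) a) := by
  induction g with
  | zero => simp [Module.End.one_eq_id]
  | succ g ih =>
    rw [pow_succ', Module.End.mul_apply, comul_handle hA, ih, Module.End.mul_eq_comp,
      LinearMap.lTensor_comp, LinearMap.comp_apply]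

theorem comul_handle_pow' (hA : IsNearlyFrobenius K A) (g : ℕ) (a : A) :
    comul (R := K) ((handle K A ^ g) a) =
      (handle K A ^ g).rTensor A (comul (R := K) a) := by
  induction g with
  | zero => simp [Module.End.one_eq_id]
  | succ g ih =>
    rw [pow_succ', Module.End.mul_apply, comul_handle' hA, ih, Module.End.mul_eq_comp,
      LinearMap.rTensor_comp, LinearMap.comp_apply]

/-- The source of the genus in sewing: k + 1 parallel tubes between two spheres enclose k handles.
-/
theorem prod_comulPow (hA : IsNearlyFrobenius K A) (k : ℕ) (a : A) :
    prod K A (k + 1) (comulPow K A (k + 1) a) = (handle K A ^ k) a := by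
  induction k generalizing a with
  | zero =>
    rw [comulPow_one, prod_cons, unitalProd_tprod]
    simp [rmul]
  | succ k ih =>
    have key : ∀ z : A ⊗[K] A, prod K A (k + 2) (cons K A (k + 1)
        ((comulPow K A (k + 1)).lTensor A z)) = (handle K A ^ k) (LinearMap.mul' K A z) :=
      fun z => by
        induction z with
        | zero => simp
        | tmul x y =>
          rw [LinearMap.lTensor_tmul, prod_cons, rmul_unitalProd k.succ_pos, ih,
            LinearMap.mul'_apply, handle_pow_mul hA]
        | add x y hx hy => simp only [map_add, hx, hy]
    rw [comulPow_succ, key, pow_succ]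
    rfl

/-- After two steps of the recursion are unfolded, this is the left Frobenius relation at δ(a). -/
theorem mulHead_comulPow (hA : IsNearlyFrobenius K A) (m : ℕ) (a : A) :
    mulHead K A m (comulPow K A (m + 2) a) = comulPow K A (m + 1) (handle K A a) := by
  have key : ∀ z : A ⊗[K] (A ⊗[K] A), mulHead K A m (cons K A (m + 1)
      ((cons K A m ∘ₗ (comulPow K A m).lTensor A).lTensor A z)) =
      cons K A m ((comulPow K A m).lTensor A ((LinearMap.mul' K A).rTensor A
        ((TensorProduct.assoc K A A A).symm z))) := fun z => by
    induction z with
    | zero => simp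
    | tmul x y =>
      induction y with
      | zero => simp
      | tmul y z => simp [mulHead_cons]
      | add x y hx hy => simp only [map_add, hx, hy, TensorProduct.tmul_add]
    | add x y hx hy => simp only [map_add, hx, hy]
  have h := LinearMap.congr_fun hA.left_frobenius (comul a)
  have h2 : comulPow K A (m + 2) a = cons K A (m + 1)
      ((cons K A m ∘ₗ (comulPow K A m).lTensor A).lTensor A
        ((comul (R := K) (A := A)).lTensor A (comul a))) := by
    rw [← LinearMap.comp_apply (LinearMap.lTensor _ _), ← LinearMap.lTensor_comp]
    rfl
  rw [h2, key]
  exact congrArg (fun z => cons K A m ((comulPow K A m).lTensor A z)) h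

theorem mulHead_cons_comulPow (hA : IsNearlyFrobenius K A) (m : ℕ) (a b : A) :
    mulHead K A m (cons K A (m + 1) (a ⊗ₜ comulPow K A (m + 1) b)) =
      comulPow K A (m + 1) (a * b) := by
  rw [comulPow_succ, comulPow_succ, hA.comul_mul_left]
  induction comul (R := K) b with
  | zero => simp
  | tmul x y => simp [mulHead_cons]
  | add x y hx hy => simp only [map_add, hx, hy, TensorProduct.tmul_add]

theorem mulPair_comulPow (hA : IsNearlyFrobenius K A) (hc : IsBicommutative K A) (m₁ m₂ : ℕ)
    (a b : A) :
    mulPair K A m₁ m₂ (comulPow K A (m₁ + 1) a ⊗ₜ comulPow K A (m₂ + 1) b) =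
      comulPow K A (m₁ + m₂ + 1) (a * b) := by
  have key : ∀ z w : A ⊗[K] A, mulPair K A m₁ m₂ (cons K A m₁ ((comulPow K A m₁).lTensor A z) ⊗ₜ
      cons K A m₂ ((comulPow K A m₂).lTensor A w)) =
      cons K A (m₁ + m₂) ((TensorPower.mulEquiv.toLinearMap ∘ₗ
        TensorProduct.map (comulPow K A m₁) (comulPow K A m₂)).lTensor A
        ((LinearMap.mul' K A).rTensor (A ⊗[K] A)
          (TensorProduct.tensorTensorTensorComm K A A A A (z ⊗ₜ w)))) := fun z w => by
    induction z with
    | zero => simp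
    | tmul x y =>
      induction w with
      | zero => simp
      | tmul z w => simp [mulPair_cons]
      | add x y hx hy => simp only [map_add, hx, hy, TensorProduct.tmul_add]
    | add x y hx hy => simp only [map_add, hx, hy, TensorProduct.add_tmul]
  -- In Sweedler notation a'b' ⊗ a'' ⊗ b'' = (id ⊗ δ)δ(ab). The right side is (δ ⊗ id)(ab' ⊗ b''),
  -- and δ(ab') = δ(b'a) = b'a' ⊗ a'' by commutativity and left linearity.
  have h : (LinearMap.mul' K A).rTensor (A ⊗[K] A) (TensorProduct.tensorTensorTensorComm K A A A A
      (comul (R := K) a ⊗ₜ comul (R := K) b)) =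
      (comul (R := K) (A := A)).lTensor A (comul (R := K) (a * b)) := by
    rw [← Coalgebra.coassoc_apply, hA.comul_mul_left]
    induction comul (R := K) b with
    | zero => simp
    | tmul x y =>
      rw [LinearMap.rTensor_tmul, LinearMap.rTensor_tmul, LinearMap.mulLeft_apply, hc.mul_comm a x,
        hA.comul_mul_left]
      induction comul (R := K) a with
      | zero => simp
      | tmul z w => simp [hc.mul_comm z x]
      | add x y hx hy => simp only [map_add, hx, hy, TensorProduct.add_tmul]
    | add x y hx hy => simp only [map_add, hx, hy, TensorProduct.tmul_add]
  rw [comulPow_succ, comulPow_succ, key, h, ← LinearMap.comp_apply (LinearMap.lTensor _ _),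
    ← LinearMap.lTensor_comp, comulPow_succ]
  congr 3
  exact LinearMap.ext (comulPow_add m₁ m₂)

end TensorOps
end Frobenius

/-! ### The surface maps satisfy both systems of axioms -/

section CobordismMaps

variable {K A : Type*} [Field K] [NonUnitalRing A] [Module K A]
    [IsScalarTower K A A] [SMulCommClass K A A] [Coalgebra K A]

open TensorOps

/-- The value `A^{⊗n} → A → A → A^{⊗m}` on a surface of genus `g`: multiply all inputs, apply the
handle operator `g` times, and comultiply. -/
noncomputable def TensorOps.surfaceMap (K A : Type*) [Field K] [NonUnitalRing A] [Module K A]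
    [IsScalarTower K A A] [SMulCommClass K A A] [Coalgebra K A] (g n m : ℕ) :
    ⨂[K]^n A →ₗ[K] ⨂[K]^m A :=
  comulPow K A m ∘ₗ (handle K A ^ g) ∘ₗ prod K A n

namespace TensorOps

theorem surfaceMap_apply (g n m : ℕ) (t : ⨂[K]^n A) :
    surfaceMap K A g n m t = comulPow K A m ((handle K A ^ g) (prod K A n t)) := rfl

theorem surfaceMap_reindex (hc : IsBicommutative K A) (g n m : ℕ) (σ : Equiv.Perm (Fin n))
    (τ : Equiv.Perm (Fin m)) (v : ⨂[K]^n A) :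
    surfaceMap K A g n m (PiTensorProduct.reindex K (fun _ => A) σ v) =
      PiTensorProduct.reindex K (fun _ => A) τ (surfaceMap K A g n m v) := by
  rw [surfaceMap_apply, surfaceMap_apply, prod_reindex hc, reindex_comulPow hc]

/-- For maps with a single input, where the tail is a scalar and `rmul` by it is scalar
multiplication. -/
theorem unitalProd_zero (t : ⨂[K]^0 A) : ∃ r : K, unitalProd K A 0 t = algebraMap K _ r ∧
    t = r • PiTensorProduct.tprod K Fin.elim0 := by
  induction t using PiTensorProduct.induction_on with
  | smul_tprod r v =>
    refine ⟨r, ?_, ?_⟩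
    · rw [map_smul, unitalProd_tprod, List.ofFn_zero, List.prod_nil, Algebra.algebraMap_eq_smul_one]
    · rw [Subsingleton.elim v Fin.elim0]
  | add x y hx hy =>
    obtain ⟨r, hr, hr'⟩ := hx
    obtain ⟨q, hq, hq'⟩ := hy
    exact ⟨r + q, by rw [map_add, hr, hq, map_add], by rw [hr', hq', add_smul]⟩

theorem rmul_algebraMap (r : K) (a : A) : rmul (algebraMap K (Unitization K A) r) a = r • a := by
  simp [rmul, Unitization.algebraMap_eq_inl]

theorem surfaceMap_zero_one_zero : surfaceMap K A 0 1 0 = counitOne K A := by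
  refine hom_ext_cons fun a t => ?_
  obtain ⟨r, hr, hr'⟩ := unitalProd_zero t
  rw [surfaceMap_apply, prod_cons, hr, counitOne_cons, rmul_algebraMap, hr']
  simp [comulPow, smul_smul, mul_comm]

theorem comulPow_one_prod (t : ⨂[K]^1 A) : comulPow K A 1 (prod K A 1 t) = t := by
  refine LinearMap.congr_fun (f := comulPow K A 1 ∘ₗ prod K A 1) (g := LinearMap.id)
    (hom_ext_cons fun a t => ?_) t
  obtain ⟨r, hr, hr'⟩ := unitalProd_zero t
  rw [LinearMap.comp_apply, prod_cons, hr, rmul_algebraMap, map_smul, comulPow_one, hr']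
  simp

theorem surfaceMap_cylinder : surfaceMap K A 0 1 1 = LinearMap.id :=
  LinearMap.ext fun t => comulPow_one_prod t

theorem surfaceMap_pants : surfaceMap K A 0 2 1 = mulHead K A 0 := by
  refine LinearMap.ext fun t => ?_
  rw [surfaceMap_apply, pow_zero, ← prod_mulHead]
  exact comulPow_one_prod _

theorem surfaceMap_copants : surfaceMap K A 0 1 2 = comulHead K A 0 := by
  refine LinearMap.ext fun t => ?_
  rw [surfaceMap_apply, pow_zero, ← comulHead_comulPow]
  exact congrArg _ (comulPow_one_prod _)

theorem surfaceMap_sewing (hA : IsNearlyFrobenius K A) (g h n k m : ℕ) :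
    surfaceMap K A h (k + 1) m ∘ₗ surfaceMap K A g n (k + 1) = surfaceMap K A (g + h + k) n m := by
  refine LinearMap.ext fun t => ?_
  rw [LinearMap.comp_apply, surfaceMap_apply, surfaceMap_apply, surfaceMap_apply,
    prod_comulPow hA, ← Module.End.mul_apply, ← Module.End.mul_apply, ← pow_add, ← pow_add]
  congr 3
  ring

/-- The outputs are split by `comulPow_add` into p free ones and j + 1 sewn ones. Multiplying the
latter gives j handles; these, the h handles and the extra inputs all act on the second factor of
one δ and slide back through it. -/
theorem surfaceMap_partialComp (hA : IsNearlyFrobenius K A) (g h n p j k m : ℕ) (hn : 0 < n) :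
    partialComp (surfaceMap K A g n (p + (j + 1))) (surfaceMap K A h (j + 1 + k) m) =
      surfaceMap K A (g + h + j) (n + k) (p + m) := by
  refine hom_ext_mulEquiv fun s t => ?_
  rw [partialComp_mulEquiv _ _ _ _ _ (comulPow_add p (j + 1) _).symm]
  set x := (handle K A ^ g) (prod K A n s)
  have key : ∀ z : A ⊗[K] A, (surfaceMap K A h (j + 1 + k) m ∘ₗ
      TensorPower.mulEquiv.toLinearMap).lTensor _ (TensorProduct.assoc K _ _ _
        (TensorProduct.map (comulPow K A p) (comulPow K A (j + 1)) z ⊗ₜ[K] t)) =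
      TensorProduct.map (comulPow K A p) (comulPow K A m)
        ((rmul (unitalProd K A k t)).lTensor A ((handle K A ^ (h + j)).lTensor A z)) := fun z => by
    induction z with
    | zero => simp
    | tmul a b =>
      simp only [TensorProduct.map_tmul, TensorProduct.assoc_tmul, LinearMap.lTensor_tmul,
        LinearMap.comp_apply, LinearEquiv.coe_coe, surfaceMap_apply]
      rw [prod_mulEquiv j.succ_pos, prod_comulPow hA, handle_pow_rmul hA, pow_add,
        Module.End.mul_apply]
    | add x y hx hy => simp only [map_add, TensorProduct.add_tmul, hx, hy]
  rw [key, ← comul_handle_pow hA, ← comul_rmul hA, comulPow_add, surfaceMap_apply,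
    prod_mulEquiv hn, handle_pow_rmul hA]
  have e : g + h + j = h + j + g := by ring
  rw [e, pow_add (handle K A) (h + j), Module.End.mul_apply]
  rfl

theorem surfaceMap_mulHead (g n m : ℕ) :
    surfaceMap K A g (n + 2) m = surfaceMap K A g (n + 1) m ∘ₗ mulHead K A n := by
  refine LinearMap.ext fun t => ?_
  rw [LinearMap.comp_apply, surfaceMap_apply, surfaceMap_apply, prod_mulHead]

theorem surfaceMap_comulHead (g n m : ℕ) :
    surfaceMap K A g n (m + 2) = comulHead K A m ∘ₗ surfaceMap K A g n (m + 1) := by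
  refine LinearMap.ext fun t => ?_
  rw [LinearMap.comp_apply, surfaceMap_apply, surfaceMap_apply, comulHead_comulPow]

theorem surfaceMap_idTensor_comulHead (hA : IsNearlyFrobenius K A) (g n m : ℕ) :
    surfaceMap K A g (n + 1) (m + 1) =
      idTensor (surfaceMap K A g (n + 1) m) ∘ₗ comulHead K A n := by
  refine hom_ext_cons fun a t => ?_
  rw [LinearMap.comp_apply, comulHead_cons, idTensor_cons]
  have key : ∀ z : A ⊗[K] A, (surfaceMap K A g (n + 1) m).lTensor A ((cons K A n).lTensor A
      (TensorProduct.assoc K A A _ (z ⊗ₜ t))) =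
      (comulPow K A m).lTensor A ((handle K A ^ g).lTensor A
        ((rmul (unitalProd K A n t)).lTensor A z)) := fun z => by
    induction z with
    | zero => simp
    | tmul x y => simp [surfaceMap_apply, prod_cons]
    | add x y hx hy => simp only [map_add, TensorProduct.add_tmul, hx, hy]
  rw [key, ← comul_rmul hA, ← comul_handle_pow hA, surfaceMap_apply, prod_cons, comulPow_succ]

/-- The case n = 0 must be excluded: `prod` vanishes there, while the left side is the identity for
g = m = 0. -/
theorem surfaceMap_mulHead_idTensor (hA : IsNearlyFrobenius K A) (g n m : ℕ) (hn : 0 < n) :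
    surfaceMap K A g (n + 1) (m + 1) =
      mulHead K A m ∘ₗ idTensor (surfaceMap K A g n (m + 1)) := by
  refine hom_ext_cons fun a t => ?_
  rw [LinearMap.comp_apply, idTensor_cons, LinearMap.lTensor_tmul, surfaceMap_apply,
    surfaceMap_apply, mulHead_cons_comulPow hA, prod_cons, rmul_unitalProd hn, handle_pow_mul hA]

/-- The two factors of δ(a) are multiplied together before the rest, which is one handle on `a`; it
then commutes with the remaining inputs. -/
theorem surfaceMap_succ_comp_comulHead (hA : IsNearlyFrobenius K A) (g n m : ℕ) :
    surfaceMap K A (g + 1) (n + 1) m = surfaceMap K A g (n + 2) m ∘ₗ comulHead K A n := by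
  refine hom_ext_cons fun a t => ?_
  rw [LinearMap.comp_apply, comulHead_cons]
  have key : ∀ z : A ⊗[K] A, prod K A (n + 2) (cons K A (n + 1) ((cons K A n).lTensor A
      (TensorProduct.assoc K A A _ (z ⊗ₜ t)))) =
      rmul (unitalProd K A n t) (LinearMap.mul' K A z) := fun z => by
    induction z with
    | zero => simp
    | tmul x y =>
      rw [TensorProduct.assoc_tmul, LinearMap.lTensor_tmul, ← prod_mulHead, mulHead_cons,
        prod_cons, LinearMap.mul'_apply]
    | add x y hx hy => simp only [map_add, TensorProduct.add_tmul, hx, hy]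
  rw [surfaceMap_apply, surfaceMap_apply, key, prod_cons, pow_succ, Module.End.mul_apply,
    handle_rmul hA]
  rfl

theorem surfaceMap_succ_mulHead_comp (hA : IsNearlyFrobenius K A) (g n m : ℕ) :
    surfaceMap K A (g + 1) n (m + 1) = mulHead K A m ∘ₗ surfaceMap K A g n (m + 2) := by
  refine LinearMap.ext fun t => ?_
  rw [LinearMap.comp_apply, surfaceMap_apply, surfaceMap_apply, mulHead_comulPow hA, pow_succ',
    Module.End.mul_apply]

/-- The two groups of inputs and handles act on different factors of δ(a), and both are pulled back
through δ. Commutativity is what permits right multiplications on the first factor to be pulled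
back. -/
theorem surfaceMap_comulPair (hA : IsNearlyFrobenius K A) (hc : IsBicommutative K A)
    (g₁ n₁ m₁ g₂ n₂ m₂ : ℕ) :
    surfaceMap K A (g₁ + g₂) (n₁ + n₂ + 1) (m₁ + m₂) = TensorPower.mulEquiv.toLinearMap ∘ₗ
      TensorProduct.map (surfaceMap K A g₁ (n₁ + 1) m₁) (surfaceMap K A g₂ (n₂ + 1) m₂) ∘ₗ
        comulPair K A n₁ n₂ := by
  refine hom_ext_cons fun a t => ?_
  obtain ⟨t, rfl⟩ := TensorPower.mulEquiv.surjective t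
  induction t with
  | zero => simp
  | add x y hx hy => simp only [map_add, TensorProduct.tmul_add, hx, hy]
  | tmul s t =>
    rw [LinearMap.comp_apply, LinearMap.comp_apply, comulPair_cons]
    have key : ∀ z : A ⊗[K] A, TensorProduct.map (surfaceMap K A g₁ (n₁ + 1) m₁)
        (surfaceMap K A g₂ (n₂ + 1) m₂) (TensorProduct.map (cons K A n₁) (cons K A n₂)
        (TensorProduct.tensorTensorTensorComm K A A (⨂[K]^n₁ A) (⨂[K]^n₂ A) (z ⊗ₜ (s ⊗ₜ t)))) =
        TensorProduct.map (comulPow K A m₁) (comulPow K A m₂)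
          ((handle K A ^ g₁).rTensor A ((handle K A ^ g₂).lTensor A
            ((rmul (unitalProd K A n₂ t)).lTensor A ((rmul (unitalProd K A n₁ s)).rTensor A z)))) :=
      fun z => by
        induction z with
        | zero => simp
        | tmul x y => simp [surfaceMap_apply, prod_cons]
        | add x y hx hy => simp only [map_add, TensorProduct.add_tmul, hx, hy]
    rw [key, ← comul_rmul' hA hc, ← comul_rmul hA, ← comul_handle_pow hA, ← comul_handle_pow' hA,
      LinearEquiv.coe_coe, comulPow_add, surfaceMap_apply, prod_cons, unitalProd_mulEquiv,
      pow_add, Module.End.mul_apply]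
    congr 3
    apply Unitization.inr_injective (R := K)
    simp only [inr_rmul, mul_assoc]

theorem surfaceMap_mulPair (hA : IsNearlyFrobenius K A) (hc : IsBicommutative K A)
    (g₁ n₁ m₁ g₂ n₂ m₂ : ℕ) (hn₁ : 0 < n₁) (hn₂ : 0 < n₂) :
    surfaceMap K A (g₁ + g₂) (n₁ + n₂) (m₁ + m₂ + 1) = mulPair K A m₁ m₂ ∘ₗ
      TensorProduct.map (surfaceMap K A g₁ n₁ (m₁ + 1)) (surfaceMap K A g₂ n₂ (m₂ + 1)) ∘ₗ
        TensorPower.mulEquiv.symm.toLinearMap := by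
  refine hom_ext_mulEquiv fun s t => ?_
  simp only [LinearMap.comp_apply, LinearEquiv.coe_coe, LinearEquiv.symm_apply_apply,
    TensorProduct.map_tmul, surfaceMap_apply]
  rw [mulPair_comulPow hA hc, prod_mulEquiv hn₁, rmul_unitalProd hn₂, handle_pow_mul hA,
    pow_add, Module.End.mul_apply, ← handle_pow_mul hA g₁, hc.mul_comm (prod K A n₁ s),
    handle_pow_mul hA g₁, hc.mul_comm ((handle K A ^ g₂) _)]

end TensorOps

/-- The system of maps `TensorOps.surfaceMap`. -/
noncomputable def surfaceMaps (K A : Type*) [Field K] [NonUnitalRing A] [Module K A]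
    [IsScalarTower K A A] [SMulCommClass K A A] [Coalgebra K A] : CobordismMaps K A :=
  fun g n m _ => surfaceMap K A g n m

theorem isAlmostTQFT_surfaceMaps (hA : IsNearlyFrobenius K A) (hc : IsBicommutative K A) :
    IsAlmostTQFT (surfaceMaps K A) where
  cylinder := surfaceMap_cylinder
  disk := surfaceMap_zero_one_zero
  pants := surfaceMap_pants
  copants := surfaceMap_copants
  symmetry g n m _ := surfaceMap_reindex hc g n m
  sewing g h n k m _ := surfaceMap_sewing hA g h n k m
  partial_sewing g h n p j k m hn := surfaceMap_partialComp hA g h n p j k m hn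

theorem isRibbonTQFT_surfaceMaps (hA : IsNearlyFrobenius K A) (hc : IsBicommutative K A) :
    IsRibbonTQFT (surfaceMaps K A).toRibbon where
  base _ _ := surfaceMap_zero_one_zero
  symmetry g n m _ _ σ τ _ _ v := surfaceMap_reindex hc g n m σ τ v
  red_edge g n m _ _ _ := surfaceMap_mulHead g n m
  blue_edge g n m _ _ _ := surfaceMap_comulHead g n m
  mixed_edge_red g n m _ _ _ := surfaceMap_idTensor_comulHead hA g n m
  mixed_edge_blue g n m _ γ' _ := surfaceMap_mulHead_idTensor hA g n m γ'.pos
  red_handle g n m _ _ _ := surfaceMap_succ_comp_comulHead hA g n m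
  red_separating g₁ n₁ m₁ g₂ n₂ m₂ _ _ _ _ := surfaceMap_comulPair hA hc g₁ n₁ m₁ g₂ n₂ m₂
  blue_handle g n m _ _ _ := surfaceMap_succ_mulHead_comp hA g n m
  blue_separating g₁ n₁ m₁ g₂ n₂ m₂ _ γ₁ γ₂ _ :=
    surfaceMap_mulPair hA hc g₁ n₁ m₁ g₂ n₂ m₂ γ₁.pos γ₂.pos

end CobordismMaps

/-! ### Rigidity of Almost TQFTs -/

section AlmostTQFT

variable {K A : Type*} [Field K] [NonUnitalRing A] [Module K A]
    [IsScalarTower K A A] [SMulCommClass K A A] [Coalgebra K A]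

open TensorOps

theorem TensorOps.prod_cons_elim0 (a : A) :
    prod K A 1 (cons K A 0 (a ⊗ₜ PiTensorProduct.tprod K Fin.elim0)) = a := by
  rw [prod_cons, unitalProd_tprod]
  simp [rmul]

/-- Commutativity and cocommutativity, expressed by invariance under permutations. -/
theorem IsBicommutative.of_reindex
    (hm : ∀ t : ⨂[K]^2 A, mulHead K A 0
      (PiTensorProduct.reindex K (fun _ => A) (Equiv.swap 0 1) t) = mulHead K A 0 t)
    (hd : ∀ t : ⨂[K]^1 A, PiTensorProduct.reindex K (fun _ => A) (Equiv.swap 0 1)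
      (comulHead K A 0 t) = comulHead K A 0 t) : IsBicommutative K A where
  mul_comm a b := by
    have h := hm (cons K A 1 (b ⊗ₜ cons K A 0 (a ⊗ₜ PiTensorProduct.tprod K Fin.elim0)))
    rw [reindex_swap_cons_cons, mulHead_cons, mulHead_cons] at h
    have h2 := congrArg (prod K A 1) h
    rwa [prod_cons_elim0, prod_cons_elim0] at h2
  comul_comm a := by
    have h := hd (cons K A 0 (a ⊗ₜ PiTensorProduct.tprod K Fin.elim0))
    rw [comulHead_cons] at h
    -- `uncons` followed by `prod` on the tail reads an element of the second tensor power back as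
    -- an element of A ⊗ A; under this reading the transposition becomes `TensorProduct.comm` in
    -- `key2`.
    have key : ∀ z : A ⊗[K] A, (prod K A 1).lTensor A (uncons K A 1
        (cons K A 1 ((cons K A 0).lTensor A (TensorProduct.assoc K A A _
          (z ⊗ₜ PiTensorProduct.tprod K Fin.elim0))))) = z := fun z => by
      induction z with
      | zero => simp
      | tmul x y => simp [uncons_cons, prod_cons_elim0]
      | add x y hx hy => simp only [map_add, TensorProduct.add_tmul, hx, hy]
    have key2 : ∀ z : A ⊗[K] A, (prod K A 1).lTensor A (uncons K A 1
        (PiTensorProduct.reindex K (fun _ => A) (Equiv.swap (0 : Fin 2) 1)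
        (cons K A 1 ((cons K A 0).lTensor A (TensorProduct.assoc K A A _
          (z ⊗ₜ PiTensorProduct.tprod K Fin.elim0)))))) = TensorProduct.comm K A A z := fun z => by
      induction z with
      | zero => simp
      | tmul x y => simp [uncons_cons, prod_cons_elim0, reindex_swap_cons_cons]
      | add x y hx hy => simp only [map_add, TensorProduct.add_tmul, hx, hy]
    have h2 := congrArg (fun t => (prod K A 1).lTensor A (uncons K A 1 t)) h
    simp only [key] at h2
    exact (key2 _).symm.trans h2

namespace IsAlmostTQFT

variable {ω : CobordismMaps K A}

theorem isBicommutative (hω : IsAlmostTQFT ω) : IsBicommutative K A := by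
  refine .of_reindex (fun t => ?_) fun t => ?_
  · rw [← hω.pants, hω.symmetry 0 2 1 two_pos (Equiv.swap 0 1) 1, reindex_one]
  · rw [← hω.copants, ← hω.symmetry 0 1 2 one_pos 1 (Equiv.swap 0 1), reindex_one]

/-- Sewing one leg of the copants to a surface with m outputs yields one with 1 + m. `surfaceMap`
satisfies the same identity, so agreement propagates and nothing is computed; the next two lemmas
use the same device. -/
theorem zero_one (hω : IsAlmostTQFT ω) (hA : IsNearlyFrobenius K A) (m : ℕ) :
    ω 0 1 m one_pos = surfaceMap K A 0 1 m := by
  induction m with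
  | zero => rw [hω.disk, surfaceMap_zero_one_zero]
  | succ m ih =>
    have h := hω.partial_sewing 0 0 1 1 0 0 m one_pos
    have h2 := surfaceMap_partialComp hA 0 0 1 1 0 0 m one_pos
    have h3 : ω 0 1 2 one_pos = surfaceMap K A 0 1 2 := by rw [hω.copants, surfaceMap_copants]
    rw [Nat.add_comm m 1]
    refine h.symm.trans (Eq.trans ?_ h2)
    exact congrArg₂ (partialComp (n := 1) (p := 1) (j := 1) (k := 0) (m := m)) h3 ih

theorem zero_succ_one (hω : IsAlmostTQFT ω) (hA : IsNearlyFrobenius K A) (n : ℕ) (hn : 0 < n) :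
    ω 0 n 1 hn = surfaceMap K A 0 n 1 := by
  induction n, hn using Nat.le_induction with
  | base => rw [hω.cylinder, surfaceMap_cylinder]
  | succ n hn ih =>
    obtain ⟨n, rfl⟩ := Nat.exists_eq_add_of_le hn
    have h := hω.partial_sewing 0 0 2 0 0 n 1 two_pos
    have h2 := surfaceMap_partialComp hA 0 0 2 0 0 n 1 two_pos
    have h3 : ω 0 2 1 two_pos = surfaceMap K A 0 2 1 := by rw [hω.pants, surfaceMap_pants]
    -- The number of inputs is generalized because sewing produces it in the form 2 + n and the
    -- positivity proof depends on it.
    suffices ∀ (N : ℕ) (hN : 0 < N), N = 2 + n → ω 0 N 1 hN = surfaceMap K A 0 N 1 from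
      this _ _ (by omega)
    rintro _ _ rfl
    refine h.symm.trans (Eq.trans ?_ h2)
    exact congrArg₂ (partialComp (n := 2) (p := 0) (j := 1) (k := n) (m := 1)) h3 ih

theorem one_one (hω : IsAlmostTQFT ω) (hA : IsNearlyFrobenius K A) (g : ℕ) :
    ω g 1 1 one_pos = surfaceMap K A g 1 1 := by
  induction g with
  | zero => rw [hω.cylinder, surfaceMap_cylinder]
  | succ g ih =>
    -- The torus with one input and one output is the copants followed by the pants.
    have h1 : ω 1 1 1 one_pos = surfaceMap K A 1 1 1 := by
      refine (hω.sewing 0 0 1 1 1 one_pos).symm.trans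
        (Eq.trans ?_ (surfaceMap_sewing hA 0 0 1 1 1))
      rw [zero_succ_one hω hA, zero_one hω hA]
    refine (hω.sewing g 1 1 0 1 one_pos).symm.trans
      (Eq.trans ?_ (surfaceMap_sewing hA g 1 1 0 1))
    exact congrArg₂ LinearMap.comp h1 ih

/-- An Almost TQFT is determined by its algebra. -/
theorem eq_surfaceMaps (hω : IsAlmostTQFT ω) (hA : IsNearlyFrobenius K A) :
    ω = surfaceMaps K A := by
  funext g n m hn
  -- Normal form of a surface: n inputs to one circle, g handles on a cylinder, one circle to m
  -- outputs.
  have h1 : ω g n 1 hn = surfaceMap K A g n 1 := by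
    have h := hω.sewing 0 g n 0 1 hn
    have h2 := surfaceMap_sewing hA 0 g n 0 1
    simp only [Nat.zero_add, Nat.add_zero] at h h2
    rw [← h, ← h2, one_one hω hA, zero_succ_one hω hA]
  refine (hω.sewing g 0 n 0 m hn).symm.trans (Eq.trans ?_ (surfaceMap_sewing hA g 0 n 0 m))
  exact congrArg₂ LinearMap.comp (zero_one hω hA m) h1

end IsAlmostTQFT

end AlmostTQFT

/-! ### First return maps -/

section FirstReturn

variable {X Y : Type}

theorem Equiv.Perm.SameCycle.map_eq {Z : Type*} {σ : Equiv.Perm X} {f : X → Z}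
    (hf : ∀ y, f (σ y) = f y) {y z : X} (h : σ.SameCycle y z) : f y = f z := by
  obtain ⟨n, rfl⟩ := h
  induction n using Int.induction_on with
  | zero => rfl
  | succ n ih => rw [add_comm, zpow_add, zpow_one, Equiv.Perm.mul_apply, hf, ih]
  | pred n ih =>
    rw [ih, ← hf ((σ ^ (-(n : ℤ) - 1)) y), ← Equiv.Perm.mul_apply, ← zpow_one_add]
    congr 3
    ring

theorem Equiv.Perm.sameCycle_pow (σ : Equiv.Perm X) (n : ℕ) (y : X) :
    σ.SameCycle y ((σ ^ n) y) := ⟨n, by simp⟩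

/-- `ψ` is the first return map of `σ` on the range of `e`. -/
def IsFirstReturn (σ : Equiv.Perm X) (e : Y → X) (ψ : Equiv.Perm Y) : Prop :=
  ∀ y, ∃ k : ℕ, (σ ^ (k + 1)) (e y) = e (ψ y) ∧ ∀ i < k, (σ ^ (i + 1)) (e y) ∉ Set.range e

/-- A walk along σ from `e y` to `e z` cannot jump over the first return `e (ψ y)`, so strong
induction on its length cuts it into steps of ψ. -/
theorem IsFirstReturn.sameCycle_iff [Finite X] {σ : Equiv.Perm X} {e : Y → X}
    {ψ : Equiv.Perm Y} (h : IsFirstReturn σ e ψ) (he : Function.Injective e) (y z : Y) :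
    ψ.SameCycle y z ↔ σ.SameCycle (e y) (e z) := by
  constructor
  · intro hyz
    have key : ∀ y, (⟦e (ψ y)⟧ : Quotient (Equiv.Perm.SameCycle.setoid σ)) = ⟦e y⟧ := fun y => by
      obtain ⟨k, hk, -⟩ := h y
      rw [← hk]
      exact Quotient.sound (σ.sameCycle_pow _ _).symm
    exact Quotient.exact (hyz.map_eq (f := fun y =>
      (⟦e y⟧ : Quotient (Equiv.Perm.SameCycle.setoid σ))) key)
  · intro hyz
    obtain ⟨n, hn⟩ := hyz.exists_nat_pow_eq
    clear hyz
    induction n using Nat.strong_induction_on generalizing y with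
    | _ n ih =>
      obtain ⟨k, hk, hk'⟩ := h y
      rcases Nat.eq_zero_or_pos n with rfl | hpos
      · rw [he hn]
      · have hkn : k + 1 ≤ n := by
          by_contra hlt
          refine hk' (n - 1) (by omega) ⟨z, ?_⟩
          rw [Nat.sub_add_cancel hpos, hn]
        have h2 := ih (n - (k + 1)) (by omega) (ψ y) (by
          rw [← hk, ← Equiv.Perm.mul_apply, ← pow_add, Nat.sub_add_cancel hkn, hn])
        exact (Equiv.Perm.sameCycle_apply_left (f := ψ)).1 h2

theorem exists_isFirstReturn [Finite X] (σ : Equiv.Perm X) {e : Y → X}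
    (he : Function.Injective e) : ∃ ψ : Equiv.Perm Y, IsFirstReturn σ e ψ := by
  classical
  have : Finite Y := Finite.of_injective e he
  have hex : ∀ y, ∃ k : ℕ, (σ ^ (k + 1)) (e y) ∈ Set.range e := fun y =>
    ⟨orderOf σ - 1, y, by rw [Nat.sub_add_cancel (orderOf_pos σ), pow_orderOf_eq_one]; rfl⟩
  choose ψ hψ using fun y => Nat.find_spec (hex y)
  have hmin : ∀ y, ∀ i < Nat.find (hex y), (σ ^ (i + 1)) (e y) ∉ Set.range e :=
    fun y i hi => Nat.find_min (hex y) hi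
  -- If two excursions end at the same point, cancelling the shorter one shows that the longer one
  -- passes through its starting point, hence returns too early unless the lengths agree.
  have key : ∀ y z, Nat.find (hex y) ≤ Nat.find (hex z) → ψ y = ψ z → y = z := by
    intro y z hle hyz
    have h := (hψ y).symm.trans ((congrArg e hyz).trans (hψ z))
    obtain ⟨d, hd⟩ := Nat.exists_eq_add_of_le hle
    rw [hd, show Nat.find (hex y) + d + 1 = (Nat.find (hex y) + 1) + d by ring, pow_add _ _ d,
      Equiv.Perm.mul_apply] at h
    have h2 := (σ ^ (Nat.find (hex y) + 1)).injective h
    rcases d with _ | d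
    · exact he h2
    · exact absurd ⟨y, h2⟩ (hmin z d (by omega))
  have hinj : Function.Injective ψ := fun y z hyz => by
    rcases le_total (Nat.find (hex y)) (Nat.find (hex z)) with h | h
    · exact key y z h hyz
    · exact (key z y h hyz.symm).symm
  exact ⟨Equiv.ofBijective ψ (Finite.injective_iff_bijective.1 hinj), fun y =>
    ⟨_, (hψ y).symm, hmin y⟩⟩

namespace CellGraph

theorem numOrbits_eq_card_range {Z : Type*} {σ : Equiv.Perm X} (f : X → Z)
    (hf : ∀ y z, σ.SameCycle y z ↔ f y = f z) : numOrbits σ = (Set.range f).ncard := by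
  have : Equiv.Perm.SameCycle.setoid σ = Setoid.ker f := Setoid.ext fun y z => hf y z
  rw [numOrbits, this]
  exact Nat.card_congr (Setoid.quotientKerEquivRange f)

/-- Orbits of `φ` are orbits of its first return map, or they avoid the range of `e`; there `φ` may
be replaced by `σ`. -/
theorem numOrbits_eq_add_ncard [Finite X] {Z : Type*} [Finite Z] {σ φ : Equiv.Perm X} {e : Y → X}
    {ψ : Equiv.Perm Y} (h : IsFirstReturn φ e ψ) (he : Function.Injective e)
    (hσ : ∀ y, y ∉ Set.range e → σ y = φ y) (f : X → Z)
    (hf : ∀ y z, σ.SameCycle y z ↔ f y = f z) :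
    numOrbits φ = numOrbits ψ + (Set.range f \ Set.range (f ∘ e)).ncard := by
  classical
  -- An orbit that avoids the range of `e` sees only points where the two permutations agree, so it
  -- is an orbit of both.
  have agree : ∀ (τ₁ τ₂ : Equiv.Perm X), (∀ y, y ∉ Set.range e → τ₁ y = τ₂ y) → ∀ z,
      (∀ y, ¬ τ₁.SameCycle (e y) z) → ∀ n : ℕ, (τ₁ ^ n) z = (τ₂ ^ n) z := by
    intro τ₁ τ₂ hτ z hz n
    induction n with
    | zero => rfl
    | succ n ih =>
      rw [pow_succ', pow_succ', Equiv.Perm.mul_apply, Equiv.Perm.mul_apply, ← ih]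
      refine hτ _ ?_
      rintro ⟨y, hy⟩
      exact hz y (hy ▸ (τ₁.sameCycle_pow n z).symm)
  have agree' : ∀ (τ₁ τ₂ : Equiv.Perm X), (∀ y, y ∉ Set.range e → τ₁ y = τ₂ y) → ∀ z,
      (∀ y, ¬ τ₁.SameCycle (e y) z) → ∀ w, τ₁.SameCycle z w ↔ τ₂.SameCycle z w := by
    intro τ₁ τ₂ hτ z hz w
    constructor
    · intro hw
      obtain ⟨n, rfl⟩ := hw.exists_nat_pow_eq
      rw [agree τ₁ τ₂ hτ z hz]
      exact τ₂.sameCycle_pow _ _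
    · intro hw
      obtain ⟨n, rfl⟩ := hw.exists_nat_pow_eq
      rw [← agree τ₁ τ₂ hτ z hz]
      exact τ₁.sameCycle_pow _ _
  have avoid : ∀ z, (∀ y, ¬ φ.SameCycle (e y) z) ↔ f z ∉ Set.range (f ∘ e) := by
    intro z
    constructor
    · rintro hz ⟨y, hy⟩
      exact hz y (((agree' φ σ (fun y hy => (hσ y hy).symm) z hz _).2 ((hf z (e y)).2 hy.symm)).symm)
    · intro hz y hy
      have hz' : ∀ y, ¬ σ.SameCycle (e y) z := fun y hy => hz ⟨y, (hf _ _).1 hy⟩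
      exact hz' y ((agree' σ φ hσ z hz' _).2 hy.symm).symm
  -- A complete invariant of the orbits of φ: an orbit meeting the range of `e` is labeled by its
  -- orbit of ψ, any other by the value of `f`.
  let F : X → Quotient (Equiv.Perm.SameCycle.setoid ψ) ⊕ Z := fun z =>
    if hz : ∃ y, φ.SameCycle (e y) z then Sum.inl ⟦hz.choose⟧ else Sum.inr (f z)
  have hFin : ∀ z y, φ.SameCycle (e y) z → F z = Sum.inl ⟦y⟧ := by
    intro z y hy
    have hz : ∃ y, φ.SameCycle (e y) z := ⟨y, hy⟩
    simp only [F, dif_pos hz]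
    refine congrArg _ (Quotient.sound ?_)
    exact (h.sameCycle_iff he _ _).2 (hz.choose_spec.trans hy.symm)
  have hFout : ∀ z, (∀ y, ¬ φ.SameCycle (e y) z) → F z = Sum.inr (f z) := by
    intro z hz
    simp only [F, dif_neg (not_exists.2 hz)]
  have hF : ∀ y z, φ.SameCycle y z ↔ F y = F z := by
    intro y z
    constructor
    · intro hyz
      by_cases hy : ∃ w, φ.SameCycle (e w) y
      · obtain ⟨w, hw⟩ := hy
        rw [hFin y w hw, hFin z w (hw.trans hyz)]
      · rw [not_exists] at hy
        rw [hFout y hy, hFout z fun w hw => hy w (hw.trans hyz.symm), ← (hf y z).1]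
        exact (agree' φ σ (fun y hy => (hσ y hy).symm) y hy z).1 hyz
    · intro hyz
      by_cases hy : ∃ w, φ.SameCycle (e w) y
      · obtain ⟨w, hw⟩ := hy
        by_cases hz : ∃ w, φ.SameCycle (e w) z
        · obtain ⟨u, hu⟩ := hz
          rw [hFin y w hw, hFin z u hu] at hyz
          have := Quotient.exact (Sum.inl_injective hyz)
          exact hw.symm.trans (((h.sameCycle_iff he _ _).1 this).trans hu)
        · rw [not_exists] at hz
          rw [hFin y w hw, hFout z hz] at hyz
          exact absurd hyz Sum.inl_ne_inr
      · rw [not_exists] at hy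
        by_cases hz : ∃ w, φ.SameCycle (e w) z
        · obtain ⟨u, hu⟩ := hz
          rw [hFin z u hu, hFout y hy] at hyz
          exact absurd hyz Sum.inr_ne_inl
        · rw [not_exists] at hz
          rw [hFout y hy, hFout z hz] at hyz
          exact (agree' φ σ (fun y hy => (hσ y hy).symm) y hy z).2
            ((hf y z).2 (Sum.inr_injective hyz))
  have : Finite Y := Finite.of_injective e he
  have hrange : Set.range F =
      Set.range Sum.inl ∪ Sum.inr '' (Set.range f \ Set.range (f ∘ e)) := by
    ext w
    constructor
    · rintro ⟨z, rfl⟩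
      by_cases hz : ∃ w, φ.SameCycle (e w) z
      · obtain ⟨u, hu⟩ := hz
        exact Or.inl ⟨_, (hFin z u hu).symm⟩
      · rw [not_exists] at hz
        exact Or.inr ⟨f z, ⟨⟨z, rfl⟩, (avoid z).1 hz⟩, (hFout z hz).symm⟩
    · rintro (⟨q, rfl⟩ | ⟨_, ⟨⟨z, rfl⟩, hz⟩, rfl⟩)
      · obtain ⟨y, rfl⟩ := Quotient.exists_rep q
        exact ⟨e y, hFin _ y (Equiv.Perm.SameCycle.refl _ _)⟩
      · exact ⟨z, hFout z ((avoid z).2 hz)⟩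
  rw [numOrbits_eq_card_range F hF, hrange, Set.ncard_union_eq, Set.ncard_image_of_injective _
    Sum.inr_injective]
  · congr 1
    rw [← Set.image_univ, Set.ncard_image_of_injective _ Sum.inl_injective, Set.ncard_univ]
    rfl
  · rw [Set.disjoint_left]
    rintro _ ⟨q, rfl⟩ ⟨z, -, hz⟩
    exact Sum.inr_ne_inl hz

end CellGraph

end FirstReturn

/-! ### Contractions of cell graphs -/

namespace CellGraph

variable {V V' : Type}

theorem contractedNext_left (γ : CellGraph V) (x : γ.HalfEdge) :
    γ.contractedNext x x = γ.next (γ.opp x) := by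
  simp [contractedNext]

theorem contractedNext_right (γ : CellGraph V) (x : γ.HalfEdge) :
    γ.contractedNext x (γ.opp x) = γ.next x := by
  simp [contractedNext]

theorem contractedNext_of_ne (γ : CellGraph V) {x y : γ.HalfEdge} (h : y ≠ x)
    (h' : y ≠ γ.opp x) : γ.contractedNext x y = γ.next y := by
  classical
  rw [contractedNext, Equiv.Perm.mul_apply, Equiv.swap_apply_of_ne_of_ne h h']

theorem vert_next (γ : CellGraph V) (x : γ.HalfEdge) : γ.vert (γ.next x) = γ.vert x :=
  ((γ.sameCycle_iff _ _).1 (γ.next.sameCycle_pow 1 x)).symm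

/-- Twice the number of edges is the number of half-edges. -/
theorem two_mul_numEdges (γ : CellGraph V) : 2 * γ.numEdges = Nat.card γ.HalfEdge := by
  classical
  have := γ.finite
  have := Fintype.ofFinite γ.HalfEdge
  let s := Equiv.Perm.SameCycle.setoid γ.opp
  have : Fintype (Quotient s) := Fintype.ofFinite _
  have key : ∀ q : Quotient s, Nat.card {x // (⟦x⟧ : Quotient s) = q} = 2 := by
    intro q
    obtain ⟨y, rfl⟩ := Quotient.exists_rep q
    have : {x | (⟦x⟧ : Quotient s) = ⟦y⟧} = {y, γ.opp y} := by
      ext x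
      simp only [Set.mem_ofPred_eq, Set.mem_insert_iff, Set.mem_singleton_iff]
      constructor
      · intro h
        obtain ⟨n, hn⟩ := (Quotient.exact h.symm : γ.opp.SameCycle y x).exists_nat_pow_eq
        have h2 : γ.opp ^ 2 = 1 := Equiv.ext fun z => by simp [pow_two, γ.opp_opp]
        rcases Nat.even_or_odd' n with ⟨c, rfl | rfl⟩
        · left; simpa [pow_mul, h2] using hn.symm
        · right; simpa [pow_mul, h2, pow_succ] using hn.symm
      · rintro (rfl | rfl)
        · rfl
        · exact Quotient.sound (γ.opp.sameCycle_pow 1 y).symm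
    have h2 : Set.ncard {x | (⟦x⟧ : Quotient s) = ⟦y⟧} = 2 := by
      rw [this, Set.ncard_pair (γ.opp_ne y).symm]
    exact h2
  rw [← Nat.card_congr (Equiv.sigmaFiberEquiv fun x => (⟦x⟧ : Quotient s)), Nat.card_sigma]
  simp only [key, Finset.sum_const, smul_eq_mul, Finset.card_univ]
  rw [mul_comm, ← Nat.card_eq_fintype_card]
  rfl

theorem IsContraction.numEdges {γ : CellGraph V} {γ' : CellGraph V'} {x : γ.HalfEdge}
    {e : γ'.HalfEdge → γ.HalfEdge} (h : γ.IsContraction γ' x e) :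
    γ.numEdges = γ'.numEdges + 1 := by
  classical
  have := γ.finite
  have h1 := γ.two_mul_numEdges
  have h2 := γ'.two_mul_numEdges
  have h3 : (Set.range e) = ({x, γ.opp x} : Set _)ᶜ := by
    ext y
    simp [h.mem_range]
  have h4 : (Set.range e).ncard = Nat.card γ'.HalfEdge := by
    rw [← Set.image_univ, Set.ncard_image_of_injective _ h.injective, Set.ncard_univ]
  have h5 := Set.ncard_add_ncard_compl ({x, γ.opp x} : Set γ.HalfEdge)
  rw [← h3, h4, Set.ncard_pair (γ.opp_ne x).symm] at h5
  omega

theorem IsContraction.card_halfEdge {γ : CellGraph V} {γ' : CellGraph V'} {x : γ.HalfEdge}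
    {e : γ'.HalfEdge → γ.HalfEdge} (h : γ.IsContraction γ' x e) :
    Nat.card γ.HalfEdge = Nat.card γ'.HalfEdge + 2 := by
  rw [← two_mul_numEdges, ← two_mul_numEdges, h.numEdges]
  ring

/-- The boundary permutation is not changed by a contraction, except that two half-edges are
removed. -/
theorem IsContraction.isFirstReturn_face {γ : CellGraph V} {γ' : CellGraph V'} {x : γ.HalfEdge}
    {e : γ'.HalfEdge → γ.HalfEdge} (h : γ.IsContraction γ' x e) :
    IsFirstReturn (γ.next * γ.opp) e (γ'.next * γ'.opp) := by
  intro y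
  obtain ⟨k, hk, hk'⟩ := h.next (γ'.opp y)
  -- Off `x` and `opp x`, `contractedNext` is `next`, which gives the first step. On these two
  -- half-edges its swap is exactly `opp`, so both walks continue identically until they leave the
  -- deleted edge.
  have key : ∀ i ≤ k, ((γ.next * γ.opp) ^ (i + 1)) (e y) =
      (γ.contractedNext x ^ (i + 1)) (e (γ'.opp y)) := by
    intro i
    induction i with
    | zero =>
      intro _
      have := (h.mem_range (e (γ'.opp y))).1 ⟨_, rfl⟩
      simp only [zero_add, pow_one, Equiv.Perm.mul_apply, ← h.opp]
      rw [γ.contractedNext_of_ne this.1 this.2]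
    | succ i ih =>
      intro hi
      rw [pow_succ', Equiv.Perm.mul_apply, ih (by omega), pow_succ' _ (i + 1),
        Equiv.Perm.mul_apply _ (γ.contractedNext x ^ (i + 1))]
      have h2 := hk' i (by omega)
      rw [h.mem_range, not_and_or, not_not, not_not] at h2
      rcases h2 with h2 | h2 <;> rw [h2, Equiv.Perm.mul_apply]
      · rw [contractedNext_left]
      · rw [contractedNext_right, γ.opp_opp]
  refine ⟨k, (key k le_rfl).trans hk, fun i hi => ?_⟩
  rw [key i hi.le]
  exact hk' i hi

/-- The number of faces is not changed by a contraction. Here `f` is the map to the vertices of the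
contracted graph on all half-edges. -/
theorem IsContraction.numFaces [Finite V'] {γ : CellGraph V} {γ' : CellGraph V'} {x : γ.HalfEdge}
    {e : γ'.HalfEdge → γ.HalfEdge} (h : γ.IsContraction γ' x e) (f : γ.HalfEdge → V')
    (hf : ∀ y z, (γ.contractedNext x).SameCycle y z ↔ f y = f z)
    (hv : ∀ y, γ'.vert y = f (e y))
    (hiso : Nat.card {v // ∀ x, γ.vert x ≠ v} = Nat.card {v // ∀ x, f x ≠ v}) :
    γ.numFaces = γ'.numFaces := by
  have := γ.finite
  have h1 := numOrbits_eq_add_ncard h.isFirstReturn_face h.injective (σ := γ.contractedNext x)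
    (fun y hy => by
      rw [h.mem_range, not_and_or, not_not, not_not] at hy
      rcases hy with rfl | rfl
      · rw [contractedNext_left, Equiv.Perm.mul_apply]
      · rw [contractedNext_right, Equiv.Perm.mul_apply, γ.opp_opp]) f hf
  have hcomp : ∀ (g : γ.HalfEdge → V'), Nat.card {v // ∀ x, g x ≠ v} = (Set.range g)ᶜ.ncard := by
    intro g
    rw [← Nat.card_coe_set_eq]
    refine Nat.card_congr (Equiv.subtypeEquivRight fun v => ?_)
    simp
  have hcomp' : Nat.card {v // ∀ x, γ'.vert x ≠ v} = (Set.range (f ∘ e))ᶜ.ncard := by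
    rw [← Nat.card_coe_set_eq]
    refine Nat.card_congr (Equiv.subtypeEquivRight fun v => ?_)
    simp [hv]
  -- A face made only of deleted half-edges is a vertex that loses all its half-edges; it survives
  -- as the face of a newly isolated vertex. This is why isolated vertices count as faces.
  have h2 : (Set.range f \ Set.range (f ∘ e)).ncard + (Set.range f)ᶜ.ncard =
      (Set.range (f ∘ e))ᶜ.ncard := by
    rw [← Set.ncard_union_eq]
    · congr 1
      ext v
      have : v ∈ Set.range (f ∘ e) → v ∈ Set.range f := by
        rintro ⟨y, rfl⟩
        exact ⟨e y, rfl⟩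
      simp only [Set.mem_union, Set.mem_sdiff, Set.mem_compl_iff]
      tauto
    · exact Set.disjoint_left.2 fun v hv hv' => hv' hv.1
  rw [CellGraph.numFaces, CellGraph.numFaces, h1, hiso, hcomp, hcomp', ← h2]
  ring

/-- Contraction of the edge with halves `x` and `opp x`. -/
theorem exists_isContraction (γ : CellGraph V) (x : γ.HalfEdge) (f : γ.HalfEdge → V')
    (hf : ∀ y z, (γ.contractedNext x).SameCycle y z ↔ f y = f z) :
    ∃ (γ' : CellGraph V') (e : γ'.HalfEdge → γ.HalfEdge),
      γ.IsContraction γ' x e ∧ ∀ y, γ'.vert y = f (e y) := by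
  have := γ.finite
  let Y := {y : γ.HalfEdge // y ≠ x ∧ y ≠ γ.opp x}
  obtain ⟨ψ, hψ⟩ := exists_isFirstReturn (γ.contractedNext x) (e := ((↑) : Y → γ.HalfEdge))
    Subtype.val_injective
  have hopp : ∀ y, (y ≠ x ∧ y ≠ γ.opp x) ↔ (γ.opp y ≠ x ∧ γ.opp y ≠ γ.opp x) := by
    intro y
    rw [γ.opp.injective.ne_iff, and_comm]
    refine and_congr_left fun _ => not_congr ⟨?_, ?_⟩
    · rintro rfl; exact γ.opp_opp x
    · rintro rfl; exact (γ.opp_opp y).symm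
  refine ⟨⟨Y, inferInstance, γ.opp.subtypePerm fun y => (hopp y).symm, fun y => ?_, fun y hy => ?_,
    ψ, fun y => f y, fun y z => ?_⟩, Subtype.val, ⟨Subtype.val_injective, fun y => ?_, fun y => rfl,
    hψ⟩, fun y => rfl⟩
  · exact Subtype.ext (γ.opp_opp y)
  · exact γ.opp_ne y (congrArg Subtype.val hy)
  · rw [hψ.sameCycle_iff Subtype.val_injective, hf]
  · exact Subtype.range_coe_subtype ▸ Iff.rfl

/-! ### Contraction of an edge that is not a loop -/

theorem exists_pos_pow_eq {X : Type} [Finite X] (σ : Equiv.Perm X) (x : X) :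
    ∃ n, 0 < n ∧ (σ ^ n) x = x :=
  ⟨orderOf σ, orderOf_pos σ, by rw [pow_orderOf_eq_one]; rfl⟩

/-- From `x` the merged order jumps to the successor of `opp x` and runs around that other vertex
until it arrives at `opp x`. -/
theorem contractedNext_sameCycle_opp (γ : CellGraph V) {x : γ.HalfEdge}
    (hx : γ.vert x ≠ γ.vert (γ.opp x)) : (γ.contractedNext x).SameCycle x (γ.opp x) := by
  classical
  have := γ.finite
  have hex := exists_pos_pow_eq γ.next (γ.opp x)
  obtain ⟨hpos, hn⟩ := Nat.find_spec hex
  have hmin : ∀ i, 0 < i → i < Nat.find hex → (γ.next ^ i) (γ.opp x) ≠ γ.opp x :=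
    fun i hi hi' h => Nat.find_min hex hi' ⟨hi, h⟩
  have key : ∀ i, 0 < i → i ≤ Nat.find hex →
      (γ.contractedNext x ^ i) x = (γ.next ^ i) (γ.opp x) := by
    intro i hi
    induction i, hi using Nat.le_induction with
    | base => intro _; simp [contractedNext_left]
    | succ i hi ih =>
      intro hi'
      rw [pow_succ', Equiv.Perm.mul_apply, ih (by omega), pow_succ', Equiv.Perm.mul_apply]
      refine γ.contractedNext_of_ne ?_ (hmin i (by omega) (by omega))
      intro h
      exact hx ((congrArg γ.vert h).symm.trans
        ((γ.sameCycle_iff _ _).1 (γ.next.sameCycle_pow i _)).symm)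
  rw [← hn, ← key _ hpos le_rfl]
  exact Equiv.Perm.sameCycle_pow _ _ _

/-- `f` identifies `a` and `b`, and nothing else. -/
def Identifies (f : V → V') (a b : V) : Prop :=
  ∀ v w, f v = f w ↔ v = w ∨ (v = a ∧ w = b) ∨ (v = b ∧ w = a)

/-- As `x` and `opp x` now share a cycle, every step of `next` stays in a cycle of `contractedNext`.
Thus old vertices lie in single cycles and only the two ends merge. -/
theorem contractedNext_sameCycle_iff (γ : CellGraph V) {x : γ.HalfEdge}
    (hx : γ.vert x ≠ γ.vert (γ.opp x)) {f : V → V'}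
    (hf : Identifies f (γ.vert x) (γ.vert (γ.opp x))) (y z : γ.HalfEdge) :
    (γ.contractedNext x).SameCycle y z ↔ f (γ.vert y) = f (γ.vert z) := by
  have := γ.finite
  have hopp := γ.contractedNext_sameCycle_opp hx
  constructor
  · refine Equiv.Perm.SameCycle.map_eq (f := fun y => f (γ.vert y)) fun y => ?_
    by_cases h : y = x
    · rw [h, contractedNext_left, vert_next]
      exact (hf _ _).2 (Or.inr (Or.inr ⟨rfl, rfl⟩))
    by_cases h' : y = γ.opp x
    · rw [h', contractedNext_right, vert_next]
      exact (hf _ _).2 (Or.inr (Or.inl ⟨rfl, rfl⟩))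
    rw [γ.contractedNext_of_ne h h', vert_next]
  · have hstep : ∀ y, (γ.contractedNext x).SameCycle y (γ.next y) := by
      intro y
      by_cases h : y = x
      · rw [h, ← contractedNext_right]
        exact hopp.trans (Equiv.Perm.sameCycle_pow _ 1 _)
      by_cases h' : y = γ.opp x
      · rw [h', ← contractedNext_left]
        exact hopp.symm.trans (Equiv.Perm.sameCycle_pow _ 1 _)
      rw [← γ.contractedNext_of_ne h h']
      exact Equiv.Perm.sameCycle_pow _ 1 _
    have hvert : ∀ y z, γ.vert y = γ.vert z → (γ.contractedNext x).SameCycle y z := by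
      intro y z h
      have hq := ((γ.sameCycle_iff y z).2 h).map_eq (f := fun y =>
        (⟦y⟧ : Quotient (Equiv.Perm.SameCycle.setoid (γ.contractedNext x)))) fun y =>
          Quotient.sound (hstep y).symm
      exact Quotient.exact hq
    intro h
    rcases (hf _ _).1 h with h | ⟨h, h'⟩ | ⟨h, h'⟩
    · exact hvert y z h
    · exact (hvert y x h).trans (hopp.trans (hvert _ z h'.symm))
    · exact (hvert y _ h).trans (hopp.symm.trans (hvert _ z h'.symm))

theorem Connected.of_edge {γ : CellGraph V} {γ' : CellGraph V'} {x : γ.HalfEdge}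
    {e : γ'.HalfEdge → γ.HalfEdge} (hc : γ.Connected) (h : γ.IsContraction γ' x e) {f : V → V'}
    (hsurj : Function.Surjective f) (hf : f (γ.vert x) = f (γ.vert (γ.opp x)))
    (hv : ∀ y, γ'.vert y = f (γ.vert (e y))) : γ'.Connected := by
  intro v w
  obtain ⟨v, rfl⟩ := hsurj v
  obtain ⟨w, rfl⟩ := hsurj w
  induction hc v w with
  | refl => exact Relation.ReflTransGen.refl
  | tail _ hstep ih =>
    obtain ⟨y, rfl, rfl⟩ := hstep
    by_cases h1 : y = x
    · rw [h1, ← hf, ← h1]; exact ih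
    by_cases h2 : y = γ.opp x
    · rw [h2, γ.opp_opp, hf, ← h2]; exact ih
    obtain ⟨y, rfl⟩ := (h.mem_range y).2 ⟨h1, h2⟩
    exact ih.tail ⟨y, hv y, by rw [hv, h.opp]⟩

/-- Contraction of an edge that is not a loop. -/
theorem exists_edgeContraction [Finite V] [Finite V'] (γ : CellGraph V) (hc : γ.Connected)
    {x : γ.HalfEdge} (hx : γ.vert x ≠ γ.vert (γ.opp x)) {f : V → V'}
    (hf : Identifies f (γ.vert x) (γ.vert (γ.opp x))) (hsurj : Function.Surjective f) :
    ∃ γ' : CellGraph V', γ.EdgeContraction γ' (γ.vert x) (γ.vert (γ.opp x)) f ∧ γ'.Connected ∧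
      γ.numEdges = γ'.numEdges + 1 ∧ γ.numFaces = γ'.numFaces ∧
      Nat.card γ.HalfEdge = Nat.card γ'.HalfEdge + 2 := by
  obtain ⟨γ', e, he, hv⟩ := γ.exists_isContraction x (fun y => f (γ.vert y))
    (γ.contractedNext_sameCycle_iff hx hf)
  refine ⟨γ', ⟨x, e, rfl, rfl, he, hv⟩,
    hc.of_edge he hsurj ((hf _ _).2 (Or.inr (Or.inl ⟨rfl, rfl⟩))) hv, he.numEdges,
    he.numFaces _ (γ.contractedNext_sameCycle_iff hx hf) hv ?_, he.card_halfEdge⟩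
  -- The ends of the edge are not isolated, so `f` is bijective on isolated vertices.
  refine Nat.card_eq_of_bijective (fun v : {v // ∀ y, γ.vert y ≠ v} =>
    (⟨f v, fun y hy => ?_⟩ : {v // ∀ y, f (γ.vert y) ≠ v})) ⟨fun v w hvw => ?_, fun v => ?_⟩
  · rcases (hf _ _).1 hy with h | ⟨-, h⟩ | ⟨-, h⟩
    · exact v.2 y h
    · exact v.2 _ h.symm
    · exact v.2 _ h.symm
  · rcases (hf _ _).1 (congrArg Subtype.val hvw) with h | ⟨h, -⟩ | ⟨h, -⟩
    · exact Subtype.ext h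
    · exact absurd h.symm (v.2 _)
    · exact absurd h.symm (v.2 _)
  · obtain ⟨w, hw⟩ := hsurj v
    exact ⟨⟨w, fun y hy => v.2 y (by rw [hy, hw])⟩, Subtype.ext hw⟩

end CellGraph

/-! ### Contraction of a loop in a graph with one vertex -/

namespace CellGraph

variable {V V' : Type}

/-- A loop `x` with the smallest number `k` of steps from `x` to `opp x`. -/
theorem exists_minimal_loop [Subsingleton V] (γ : CellGraph V) [Nonempty γ.HalfEdge] :
    ∃ (x : γ.HalfEdge) (k : ℕ), 0 < k ∧ (γ.next ^ k) x = γ.opp x ∧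
      ∀ y i, 0 < i → i < k → (γ.next ^ i) y ≠ γ.opp y := by
  classical
  have := γ.finite
  have hex : ∃ k, 0 < k ∧ ∃ x, (γ.next ^ k) x = γ.opp x := by
    obtain ⟨x⟩ := ‹Nonempty γ.HalfEdge›
    obtain ⟨k, hk⟩ :=
      ((γ.sameCycle_iff x (γ.opp x)).2 (Subsingleton.elim _ _)).exists_nat_pow_eq
    refine ⟨k, Nat.pos_of_ne_zero ?_, x, hk⟩
    rintro rfl
    exact γ.opp_ne x hk.symm
  obtain ⟨hpos, x, hx⟩ := Nat.find_spec hex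
  exact ⟨x, Nat.find hex, hpos, hx, fun y i hi hik h => Nat.find_min hex hik ⟨hi, y, h⟩⟩

/-- The half-edges reached from `x` in `1, …, k` steps. -/
def arc (γ : CellGraph V) (x : γ.HalfEdge) (k : ℕ) : Set γ.HalfEdge :=
  {y | ∃ i, 0 < i ∧ i ≤ k ∧ (γ.next ^ i) x = y}

theorem notMem_arc (γ : CellGraph V) {x : γ.HalfEdge} {k : ℕ} (hk : (γ.next ^ k) x = γ.opp x)
    (hmin : ∀ i, 0 < i → i < k → (γ.next ^ i) x ≠ γ.opp x) : x ∉ γ.arc x k := by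
  rintro ⟨i, hi, hik, h⟩
  rcases hik.lt_or_eq with hlt | rfl
  · refine hmin (k - i) (by omega) (by omega) ?_
    rw [← hk]
    conv_lhs => rw [← h]
    rw [← Equiv.Perm.mul_apply, ← pow_add, Nat.sub_add_cancel hik]
  · exact γ.opp_ne x (hk.symm.trans h)

theorem opp_mem_arc (γ : CellGraph V) {x : γ.HalfEdge} {k : ℕ} (hpos : 0 < k)
    (hk : (γ.next ^ k) x = γ.opp x) : γ.opp x ∈ γ.arc x k :=
  ⟨k, hpos, le_rfl, hk⟩

/-- The loop cuts the single cyclic order in two: `opp x`, the end of the arc, is now followed by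
its start `next x`, while `x` jumps over the arc to the successor of `opp x`. -/
theorem contractedNext_sameCycle_iff_arc [Subsingleton V] (γ : CellGraph V) {x : γ.HalfEdge}
    {k : ℕ} (hpos : 0 < k) (hk : (γ.next ^ k) x = γ.opp x)
    (hmin : ∀ i, 0 < i → i < k → (γ.next ^ i) x ≠ γ.opp x) (y z : γ.HalfEdge) :
    (γ.contractedNext x).SameCycle y z ↔ (y ∈ γ.arc x k ↔ z ∈ γ.arc x k) := by
  have := γ.finite
  have hx := γ.notMem_arc hk hmin
  have hstep : ∀ i, 0 < i → i < k →
      γ.contractedNext x ((γ.next ^ i) x) = (γ.next ^ (i + 1)) x := by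
    intro i hi hik
    rw [pow_succ', Equiv.Perm.mul_apply]
    exact γ.contractedNext_of_ne (fun h => hx ⟨i, hi, hik.le, h⟩) (hmin i hi hik)
  have hinv : ∀ y ∈ γ.arc x k, γ.contractedNext x y ∈ γ.arc x k := by
    rintro _ ⟨i, hi, hik, rfl⟩
    rcases hik.lt_or_eq with hlt | rfl
    · rw [hstep i hi hlt]
      exact ⟨i + 1, by omega, by omega, rfl⟩
    · rw [hk, contractedNext_right]
      exact ⟨1, one_pos, hi, by simp⟩
  have hinv' : ∀ y ∈ γ.arc x k, ∀ z, (γ.contractedNext x).SameCycle y z → z ∈ γ.arc x k := by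
    intro y hy z hyz
    obtain ⟨n, rfl⟩ := hyz.exists_nat_pow_eq
    clear hyz
    induction n with
    | zero => exact hy
    | succ n ih => rw [pow_succ', Equiv.Perm.mul_apply]; exact hinv _ ih
  have hin : ∀ y ∈ γ.arc x k, (γ.contractedNext x).SameCycle (γ.opp x) y := by
    rintro _ ⟨i, hi, hik, rfl⟩
    induction i, hi using Nat.le_induction with
    | base =>
      have := (γ.contractedNext x).sameCycle_pow 1 (γ.opp x)
      simpa [contractedNext_right] using this
    | succ i hi ih =>
      rw [← hstep i hi (by omega)]
      exact (ih (by omega)).trans (Equiv.Perm.sameCycle_pow _ 1 _)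
  have hout : ∀ y ∉ γ.arc x k, (γ.contractedNext x).SameCycle x y := by
    intro y hy
    obtain ⟨j, rfl⟩ := ((γ.sameCycle_iff x y).2 (Subsingleton.elim _ _)).exists_nat_pow_eq
    induction j with
    | zero => exact Equiv.Perm.SameCycle.refl _ _
    | succ j ih =>
      rw [pow_succ', Equiv.Perm.mul_apply] at hy ⊢
      by_cases hw : (γ.next ^ j) x ∈ γ.arc x k
      · obtain ⟨i, hi, hik, h⟩ := hw
        rw [← h] at hy ⊢
        rcases hik.lt_or_eq with hlt | rfl
        · exact absurd ⟨i + 1, by omega, by omega, by rw [pow_succ', Equiv.Perm.mul_apply]⟩ hy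
        · rw [hk, ← contractedNext_left]
          exact Equiv.Perm.sameCycle_pow _ 1 _
      · have h1 : (γ.next ^ j) x ≠ x := fun h => hy ⟨1, one_pos, hpos, by rw [h, pow_one]⟩
        have h2 : (γ.next ^ j) x ≠ γ.opp x := fun h => hw (h ▸ γ.opp_mem_arc hpos hk)
        rw [← γ.contractedNext_of_ne h1 h2]
        exact (ih hw).trans (Equiv.Perm.sameCycle_pow _ 1 _)
  constructor
  · exact fun h => ⟨fun hy => hinv' y hy z h, fun hz => hinv' z hz y h.symm⟩
  · intro h
    by_cases hy : y ∈ γ.arc x k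
    · exact (hin y hy).symm.trans (hin z (h.1 hy))
    · exact (hout y hy).symm.trans (hout z (mt h.2 hy))

theorem card_isolated_eq_zero {X : Type} {f : X → V} (hf : Function.Surjective f) :
    Nat.card {v // ∀ x, f x ≠ v} = 0 := by
  have : IsEmpty {v // ∀ x, f x ≠ v} := ⟨fun v => (hf v).elim v.2⟩
  exact Nat.card_of_isEmpty

/-- Splitting the vertex of a graph along a minimal loop. -/
theorem exists_split [Subsingleton V] [Finite V'] (γ : CellGraph V) {x : γ.HalfEdge} {k : ℕ}
    (hpos : 0 < k) (hk : (γ.next ^ k) x = γ.opp x)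
    (hmin : ∀ i, 0 < i → i < k → (γ.next ^ i) x ≠ γ.opp x) {a b : V'} (hab : a ≠ b)
    (hV' : ∀ v, v = a ∨ v = b) :
    ∃ (γ' : CellGraph V') (e : γ'.HalfEdge → γ.HalfEdge), γ.IsContraction γ' x e ∧
      (∀ y, γ'.vert y = a ↔ e y ∈ γ.arc x k) ∧ γ.numFaces = γ'.numFaces := by
  classical
  let f : γ.HalfEdge → V' := fun y => if y ∈ γ.arc x k then a else b
  have hfa : ∀ y, f y = a ↔ y ∈ γ.arc x k := by
    intro y
    by_cases hy : y ∈ γ.arc x k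
    · simp [f, hy]
    · simp [f, hy, hab.symm]
  have hf : ∀ y z, (γ.contractedNext x).SameCycle y z ↔ f y = f z := by
    intro y z
    rw [γ.contractedNext_sameCycle_iff_arc hpos hk hmin]
    by_cases hy : y ∈ γ.arc x k <;> by_cases hz : z ∈ γ.arc x k <;>
      simp [f, hy, hz, hab, hab.symm]
  have hsurj : Function.Surjective f := by
    intro v
    rcases hV' v with rfl | rfl
    · exact ⟨γ.opp x, if_pos (γ.opp_mem_arc hpos hk)⟩
    · exact ⟨x, if_neg (γ.notMem_arc hk hmin)⟩
  obtain ⟨γ', e, he, hv⟩ := γ.exists_isContraction x f hf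
  refine ⟨γ', e, he, fun y => by rw [hv, hfa], he.numFaces f hf hv ?_⟩
  rw [card_isolated_eq_zero hsurj, card_isolated_eq_zero fun v => ⟨x, Subsingleton.elim _ _⟩]

/-- If no loop has fewer than `k ≥ 2` steps, then the vertex is split without disconnecting the
graph. -/
theorem exists_loopContraction_connected [Subsingleton V] [Finite V'] (γ : CellGraph V)
    {x : γ.HalfEdge} {k : ℕ} (hpos : 1 < k) (hk : (γ.next ^ k) x = γ.opp x)
    (hmin : ∀ y i, 0 < i → i < k → (γ.next ^ i) y ≠ γ.opp y) {a b : V'} (hab : a ≠ b)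
    (hV' : ∀ v, v = a ∨ v = b) (v : V) (f : V' → V) :
    ∃ γ' : CellGraph V', γ.LoopContraction γ' v f ∧ γ'.Connected ∧
      γ.numEdges = γ'.numEdges + 1 ∧ γ.numFaces = γ'.numFaces ∧
      Nat.card γ.HalfEdge = Nat.card γ'.HalfEdge + 2 := by
  obtain ⟨γ', e, he, hv, hF⟩ := γ.exists_split (by omega) hk (hmin x) hab hV'
  refine ⟨γ', ⟨x, e, Subsingleton.elim _ _, Subsingleton.elim _ _, he,
    fun _ => Subsingleton.elim _ _⟩, ?_, he.numEdges, hF, he.card_halfEdge⟩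
  have hx := γ.notMem_arc hk (hmin x)
  have hy : γ.next x ∈ Set.range e := by
    rw [he.mem_range]
    refine ⟨fun h => hx ⟨1, one_pos, by omega, by simpa using h⟩, fun h => ?_⟩
    exact hmin x 1 one_pos (by omega) (by simpa using h)
  obtain ⟨y, hy⟩ := hy
  have h1 : γ'.vert y = a := (hv y).2 ⟨1, one_pos, by omega, by simpa using hy.symm⟩
  -- The edge at `next x` connects the two new vertices: were its other half also in the arc, it
  -- would be a loop with fewer than k steps.
  have h2 : γ'.vert (γ'.opp y) = b := by
    refine (hV' _).resolve_left fun h => ?_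
    rw [hv, he.opp, hy] at h
    obtain ⟨i, hi, hik, h⟩ := h
    obtain ⟨i, rfl⟩ := Nat.exists_eq_succ_of_ne_zero hi.ne'
    rcases Nat.eq_zero_or_pos i with rfl | hi0
    · exact γ.opp_ne _ (by simpa using h.symm)
    · refine hmin (γ.next x) i hi0 (by omega) ?_
      rw [← h, Nat.succ_eq_add_one, pow_succ, Equiv.Perm.mul_apply]
  have hab' : Relation.ReflTransGen (fun a b => ∃ x, γ'.vert x = a ∧ γ'.vert (γ'.opp x) = b) a b :=
    .single ⟨y, h1, h2⟩
  have hba' : Relation.ReflTransGen (fun a b => ∃ x, γ'.vert x = a ∧ γ'.vert (γ'.opp x) = b) b a :=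
    .single ⟨γ'.opp y, h2, by rw [γ'.opp_opp, h1]⟩
  intro v w
  rcases hV' v with rfl | rfl <;> rcases hV' w with rfl | rfl
  · exact .refl
  · exact hab'
  · exact hba'
  · exact .refl

/-- The graph with one vertex and no edges. -/
def point (V : Type) : CellGraph V where
  HalfEdge := Empty
  finite := inferInstance
  opp := 1
  opp_opp := nofun
  opp_ne := nofun
  next := 1
  vert := Empty.elim
  sameCycle_iff := nofun

/-- If `opp x` follows `x`, then contraction of this loop splits off a point. -/
theorem exists_loopContraction_point [Subsingleton V] (γ : CellGraph V) {x : γ.HalfEdge}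
    (hx : γ.next x = γ.opp x) (v : V) (f : V ⊕ V → V) :
    ∃ γ' : CellGraph V, γ.LoopContraction ((point V).disjUnion γ') v f ∧
      γ.numEdges = γ'.numEdges + 1 ∧ γ.numFaces = γ'.numFaces + 1 ∧
      Nat.card γ.HalfEdge = Nat.card γ'.HalfEdge + 2 := by
  have hk : (γ.next ^ 1) x = γ.opp x := by simpa using hx
  obtain ⟨γ₀, e, he, hv, hF⟩ := γ.exists_split (V' := Bool) (a := true) (b := false) one_pos hk
    (fun i hi hi' => absurd hi' (by omega)) (by simp) (by simp)
  have hvert : ∀ y, γ₀.vert y = false := by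
    intro y
    rw [← Bool.not_eq_true, hv]
    rintro ⟨i, hi, hi1, h⟩
    obtain rfl : i = 1 := by omega
    exact ((he.mem_range (e y)).1 ⟨y, rfl⟩).2 (h.symm.trans hk)
  -- For k = 1 the arc is just `opp x`, so the vertex `true` of `γ₀` is left without half-edges.
  -- Dropping it gives `γ'`.
  let γ' : CellGraph V :=
    { HalfEdge := γ₀.HalfEdge
      finite := γ₀.finite
      opp := γ₀.opp
      opp_opp := γ₀.opp_opp
      opp_ne := γ₀.opp_ne
      next := γ₀.next
      vert := fun _ => v
      sameCycle_iff := fun y z => by simp [γ₀.sameCycle_iff, hvert] }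
  refine ⟨γ', ⟨x, Sum.elim Empty.elim e, Subsingleton.elim _ _, Subsingleton.elim _ _,
    ⟨?_, fun y => ?_, ?_, ?_⟩, fun _ => Subsingleton.elim _ _⟩, he.numEdges, ?_, he.card_halfEdge⟩
  · rintro (y | y) (z | z) h
    · exact y.elim
    · exact y.elim
    · exact z.elim
    · exact congrArg Sum.inr (he.injective h)
  · rw [← he.mem_range y]
    constructor
    · rintro ⟨z | z, rfl⟩
      · exact z.elim
      · exact ⟨z, rfl⟩
    · rintro ⟨z, rfl⟩
      exact ⟨Sum.inr z, rfl⟩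
  · rintro (y | y)
    · exact y.elim
    · exact he.opp y
  · rintro (y | y)
    · exact y.elim
    · obtain ⟨k, hk, hk'⟩ := he.next y
      refine ⟨k, hk, fun i hi => ?_⟩
      rintro ⟨z | z, hz⟩
      · exact z.elim
      · exact hk' i hi ⟨z, hz⟩
  · rw [hF, CellGraph.numFaces, CellGraph.numFaces]
    change _ = _ + Nat.card {w : V // ∀ _ : γ₀.HalfEdge, v ≠ w} + 1
    simp only [hvert]
    have hV : ∀ w, v = w := fun w => Subsingleton.elim _ _
    rw [add_assoc]
    congr 1
    -- Isolated vertices of `γ₀` against those of `γ'`: two against one if no half-edge remains,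
    -- otherwise one against none.
    rcases isEmpty_or_nonempty γ₀.HalfEdge with h | h
    · have : Unique V := ⟨⟨v⟩, fun w => (hV w).symm⟩
      simp
    · have h1 : IsEmpty {w : V // ∀ _ : γ₀.HalfEdge, v ≠ w} :=
        ⟨fun w => w.2 h.some (hV w)⟩
      rw [@Nat.card_of_isEmpty _ h1, Nat.card_eq_one_iff_unique.2]
      refine ⟨⟨fun a b => Subtype.ext ?_⟩, ⟨true, by simp⟩⟩
      have ha := a.2 h.some
      have hb := b.2 h.some
      simp only [ne_eq, Bool.false_eq, Bool.not_eq_false] at ha hb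
      rw [ha, hb]

end CellGraph

/-! ### Relabelings, connectedness and the vertex maps -/

namespace CellGraph

variable {V V' : Type}

/-- The same graph with renamed vertices. -/
def relabel (γ : CellGraph V) (f : V ≃ V') : CellGraph V' :=
  { γ with
    vert := fun x => f (γ.vert x)
    sameCycle_iff := fun x y => by rw [γ.sameCycle_iff, f.injective.eq_iff] }

theorem numFaces_relabel (γ : CellGraph V) (f : V ≃ V') :
    (γ.relabel f).numFaces = γ.numFaces := by
  rw [CellGraph.numFaces, CellGraph.numFaces]
  refine congrArg₂ _ rfl (Nat.card_congr (f.subtypeEquiv fun v => ?_)).symm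
  exact forall_congr' fun x => not_congr f.injective.eq_iff.symm

theorem Connected.relabel {γ : CellGraph V} (hc : γ.Connected) (f : V ≃ V') :
    (γ.relabel f).Connected := by
  intro v w
  obtain ⟨v, rfl⟩ := f.surjective v
  obtain ⟨w, rfl⟩ := f.surjective w
  refine (hc v w).lift f ?_
  rintro _ _ ⟨x, rfl, rfl⟩
  exact ⟨x, rfl, rfl⟩

theorem isIso_relabel (γ : CellGraph V) (f : V ≃ V') :
    γ.IsIso (γ.relabel f) f (Equiv.refl γ.HalfEdge) :=
  ⟨fun _ => rfl, fun _ => rfl, fun _ => rfl⟩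

theorem numFaces_of_isEmpty (γ : CellGraph V) [h : IsEmpty γ.HalfEdge] :
    γ.numFaces = Nat.card V := by
  have h1 : numOrbits (γ.next * γ.opp) = 0 := by
    have : IsEmpty (Quotient (Equiv.Perm.SameCycle.setoid (γ.next * γ.opp))) :=
      ⟨fun q => h.elim q.out⟩
    exact Nat.card_of_isEmpty
  rw [CellGraph.numFaces, h1, zero_add]
  exact Nat.card_congr (Equiv.subtypeUnivEquiv fun v x => h.elim x)

/-- In a connected graph, an edge leaves every vertex unless it is the only one. -/
theorem Connected.exists_edge {γ : CellGraph V} (hc : γ.Connected) {v w : V} (hvw : w ≠ v) :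
    ∃ x, γ.vert x = v ∧ γ.vert (γ.opp x) ≠ v := by
  by_contra! h
  refine hvw ?_
  clear hvw
  induction hc v w with
  | refl => rfl
  | tail _ hstep ih =>
    obtain ⟨x, hx, rfl⟩ := hstep
    exact h x (hx.trans ih)

end CellGraph

namespace VertexMap

theorem identifies_merge (n m : ℕ) : CellGraph.Identifies
    (Sum.map (merge n) id : Fin (n + 2) ⊕ Fin m → Fin (n + 1) ⊕ Fin m)
    (Sum.inl 0) (Sum.inl 1) := by
  have key : ∀ i j : Fin (n + 2), merge n i = merge n j ↔
      i = j ∨ (i = 0 ∧ j = 1) ∨ (i = 1 ∧ j = 0) := by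
    intro i j
    refine Fin.cases ?_ (fun i => ?_) i <;> refine Fin.cases ?_ (fun j => ?_) j
    · simp [merge]
    · simp only [merge, Fin.cases_zero, Fin.cases_succ, id, Fin.ext_iff, Fin.val_zero,
        Fin.val_succ, Fin.val_one, true_and]
      omega
    · simp only [merge, Fin.cases_zero, Fin.cases_succ, id, Fin.ext_iff, Fin.val_zero,
        Fin.val_succ, Fin.val_one, and_true]
      omega
    · simp only [merge, Fin.cases_succ, id, Fin.ext_iff, Fin.val_zero,
        Fin.val_succ, Fin.val_one]
      omega
  rintro (i | i) (j | j) <;> simp [key]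

theorem surjective_merge (n m : ℕ) : Function.Surjective
    (Sum.map (merge n) id : Fin (n + 2) ⊕ Fin m → Fin (n + 1) ⊕ Fin m) := by
  rintro (i | i)
  · exact ⟨Sum.inl i.succ, rfl⟩
  · exact ⟨Sum.inr i, rfl⟩

theorem identifies_mixedToRed (n m : ℕ) :
    CellGraph.Identifies (mixedToRed n m) (Sum.inl 0) (Sum.inr 0) := by
  rintro (i | i) (j | j)
  · simp [mixedToRed]
  · refine Fin.cases ?_ (fun j => ?_) j <;> simp [mixedToRed]
  · refine Fin.cases ?_ (fun i => ?_) i <;> simp [mixedToRed, eq_comm]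
  · refine Fin.cases ?_ (fun i => ?_) i <;> refine Fin.cases ?_ (fun j => ?_) j <;>
      simp [mixedToRed, eq_comm]

theorem surjective_mixedToRed (n m : ℕ) : Function.Surjective (mixedToRed n m) := by
  rintro (i | i)
  · exact ⟨Sum.inl i, rfl⟩
  · exact ⟨Sum.inr i.succ, rfl⟩

theorem identifies_mixedToBlue (n m : ℕ) :
    CellGraph.Identifies (mixedToBlue n m) (Sum.inl 0) (Sum.inr 0) := by
  rintro (i | i) (j | j)
  · refine Fin.cases ?_ (fun i => ?_) i <;> refine Fin.cases ?_ (fun j => ?_) j <;>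
      simp [mixedToBlue, eq_comm]
  · refine Fin.cases ?_ (fun i => ?_) i <;> simp [mixedToBlue, eq_comm]
  · refine Fin.cases ?_ (fun j => ?_) j <;> simp [mixedToBlue]
  · simp [mixedToBlue]

theorem surjective_mixedToBlue (n m : ℕ) : Function.Surjective (mixedToBlue n m) := by
  rintro (i | i)
  · exact ⟨Sum.inl i.succ, rfl⟩
  · exact ⟨Sum.inr i, rfl⟩

end VertexMap

/-! ### Rigidity of ribbon TQFTs over a bicommutative algebra -/

section RibbonTQFT

variable {K A : Type*} [Field K] [NonUnitalRing A] [Module K A]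
    [IsScalarTower K A A] [SMulCommClass K A A] [Coalgebra K A]

open TensorOps

/-- The graph `γ` has a genus, and `Ω(γ)` is the map determined by the type of `γ`. -/
def RibbonMaps.DeterminedAt (Ω : RibbonMaps K A) {n m : ℕ} (γ : CellGraph (Fin n ⊕ Fin m)) :
    Prop :=
  ∀ (hn : 0 < n) (hc : γ.Connected), ∃ (g : ℕ) (he : n + m + γ.numFaces + 2 * g = γ.numEdges + 2),
    Ω g n m ⟨γ, hn, hc, he⟩ = surfaceMap K A g n m

namespace IsRibbonTQFT

variable {Ω : RibbonMaps K A}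

theorem determinedAt_of_relabel (hΩ : IsRibbonTQFT Ω) (hb : IsBicommutative K A) {n m : ℕ}
    (γ : CellGraph (Fin n ⊕ Fin m)) (σ : Equiv.Perm (Fin n)) (τ : Equiv.Perm (Fin m))
    (h : Ω.DeterminedAt (γ.relabel (Equiv.sumCongr σ τ))) : Ω.DeterminedAt γ := by
  intro hn hc
  obtain ⟨g, he, hg⟩ := h hn (hc.relabel _)
  have he' : n + m + γ.numFaces + 2 * g = γ.numEdges + 2 := by
    rw [γ.numFaces_relabel] at he
    exact he
  refine ⟨g, he', LinearMap.ext fun v => ?_⟩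
  have := hΩ.symmetry g n m ⟨γ, hn, hc, he'⟩ ⟨_, hn, hc.relabel _, he⟩ σ τ _
    (γ.isIso_relabel _) v
  rw [hg, surfaceMap_reindex hb g n m σ τ] at this
  exact ((PiTensorProduct.reindex K (fun _ => A) τ).injective this).symm

/-- Each contraction removes two half-edges, and the matching identity for `surfaceMap` transports
the value back. The genus is part of the claim because the contracted graph must satisfy Euler's
formula before an axiom can be applied to it. -/
theorem determinedAt (hΩ : IsRibbonTQFT Ω) (hA : IsNearlyFrobenius K A)
    (hb : IsBicommutative K A) {n m : ℕ} (γ : CellGraph (Fin n ⊕ Fin m)) : Ω.DeterminedAt γ := by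
  obtain ⟨N, hN⟩ : ∃ N, Nat.card γ.HalfEdge = N := ⟨_, rfl⟩
  induction N using Nat.strong_induction_on generalizing n m with
  | _ N ih =>
  intro hn hc
  obtain ⟨n, rfl⟩ := Nat.exists_eq_succ_of_ne_zero hn.ne'
  by_cases hV : ∃ w : Fin (n + 1) ⊕ Fin m, w ≠ Sum.inl 0
  · obtain ⟨w, hw⟩ := hV
    obtain ⟨x, hx, hx'⟩ := hc.exists_edge hw
    rcases hj : γ.vert (γ.opp x) with j | j
    · have hj0 : j ≠ 0 := fun h => hx' (by rw [hj, h])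
      obtain ⟨n, rfl⟩ : ∃ n', n = n' + 1 := by
        refine Nat.exists_eq_succ_of_ne_zero ?_
        rintro rfl
        exact hj0 (Subsingleton.elim _ _)
      -- The axioms speak of the first vertices of a color, so the far end of the edge is first
      -- moved to red 1, and in the mixed case to blue 0.
      refine hΩ.determinedAt_of_relabel hb γ (Equiv.swap j 1) 1 ?_ hn hc
      intro hn hc'
      set γ₁ := γ.relabel (Equiv.sumCongr (Equiv.swap j 1) (1 : Equiv.Perm (Fin m)))
      have h1 : γ₁.vert x = Sum.inl 0 := by
        change Equiv.sumCongr _ _ (γ.vert x) = _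
        rw [hx, Equiv.sumCongr_apply, Sum.map_inl,
          Equiv.swap_apply_of_ne_of_ne hj0.symm (by simp)]
      have h2 : γ₁.vert (γ₁.opp x) = Sum.inl 1 := by
        change Equiv.sumCongr _ _ (γ.vert (γ.opp x)) = _
        rw [hj, Equiv.sumCongr_apply, Sum.map_inl, Equiv.swap_apply_left]
      obtain ⟨γ', hγ', hc'', hE, hF, hH⟩ := γ₁.exists_edgeContraction hc'
        (x := x) (f := Sum.map (VertexMap.merge n) id) (by rw [h1, h2]; simp)
        (by rw [h1, h2]; exact VertexMap.identifies_merge n m) (VertexMap.surjective_merge n m)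
      rw [h1, h2] at hγ'
      have hH' : Nat.card γ.HalfEdge = Nat.card γ'.HalfEdge + 2 := hH
      obtain ⟨g, he, hg⟩ := ih _ (by omega) γ' rfl n.succ_pos hc''
      have he₁ : n + 1 + 1 + m + γ₁.numFaces + 2 * g = γ₁.numEdges + 2 := by omega
      refine ⟨g, he₁, ?_⟩
      rw [hΩ.red_edge g n m _ ⟨γ', n.succ_pos, hc'', he⟩ hγ', hg, ← surfaceMap_mulHead]
    · obtain ⟨m, rfl⟩ : ∃ m', m = m' + 1 := Nat.exists_eq_succ_of_ne_zero (by
        rintro rfl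
        exact j.elim0)
      refine hΩ.determinedAt_of_relabel hb γ 1 (Equiv.swap j 0) ?_ hn hc
      intro hn hc'
      set γ₁ := γ.relabel (Equiv.sumCongr (1 : Equiv.Perm (Fin (n + 1))) (Equiv.swap j 0))
      have h1 : γ₁.vert x = Sum.inl 0 := by
        change Equiv.sumCongr _ _ (γ.vert x) = _
        rw [hx]
        rfl
      have h2 : γ₁.vert (γ₁.opp x) = Sum.inr 0 := by
        change Equiv.sumCongr _ _ (γ.vert (γ.opp x)) = _
        rw [hj, Equiv.sumCongr_apply, Sum.map_inr, Equiv.swap_apply_left]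
      obtain ⟨γ', hγ', hc'', hE, hF, hH⟩ := γ₁.exists_edgeContraction hc'
        (x := x) (f := VertexMap.mixedToRed n m) (by rw [h1, h2]; simp)
        (by rw [h1, h2]; exact VertexMap.identifies_mixedToRed n m)
        (VertexMap.surjective_mixedToRed n m)
      rw [h1, h2] at hγ'
      have hH' : Nat.card γ.HalfEdge = Nat.card γ'.HalfEdge + 2 := hH
      obtain ⟨g, he, hg⟩ := ih _ (by omega) γ' rfl n.succ_pos hc''
      have he₁ : n + 1 + (m + 1) + γ₁.numFaces + 2 * g = γ₁.numEdges + 2 := by omega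
      refine ⟨g, he₁, ?_⟩
      rw [hΩ.mixed_edge_red g n m _ ⟨γ', n.succ_pos, hc'', he⟩ hγ', hg,
        ← surfaceMap_idTensor_comulHead hA]
  · push Not at hV
    obtain rfl : n = 0 := by
      by_contra h
      have := hV (Sum.inl (Fin.last n))
      simp only [Sum.inl.injEq, Fin.ext_iff, Fin.val_last, Fin.val_zero] at this
      exact h this
    obtain rfl : m = 0 := by
      by_contra h
      exact Sum.inr_ne_inl (hV (Sum.inr ⟨0, Nat.pos_of_ne_zero h⟩))
    have : Unique (Fin (0 + 1) ⊕ Fin 0) := ⟨⟨Sum.inl 0⟩, hV⟩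
    rcases isEmpty_or_nonempty γ.HalfEdge with hH | hH
    · have hE := γ.two_mul_numEdges
      rw [Nat.card_of_isEmpty] at hE
      have hF := γ.numFaces_of_isEmpty
      rw [Nat.card_unique] at hF
      refine ⟨0, by omega, ?_⟩
      rw [surfaceMap_zero_one_zero]
      exact hΩ.base _ hH
    -- Minimality restricts the possible splittings: for k > 1 the graph stays connected, and for k
    -- = 1 a point splits off.
    · obtain ⟨x, k, hpos, hk, hmin⟩ := γ.exists_minimal_loop
      rcases Nat.lt_or_ge 1 k with hk1 | hk1
      · obtain ⟨γ', hγ', hc', hE, hF, hH⟩ := γ.exists_loopContraction_connected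
          (V' := Fin (0 + 2) ⊕ Fin 0) hk1 hk hmin (a := Sum.inl 0) (b := Sum.inl 1) (by simp)
          (by rintro (i | i)
              · fin_cases i <;> simp
              · exact i.elim0) (Sum.inl 0) (Sum.map (VertexMap.merge 0) id)
        obtain ⟨g, he, hg⟩ := ih _ (by omega) γ' rfl two_pos hc'
        refine ⟨g + 1, by omega, ?_⟩
        rw [hΩ.red_handle g 0 0 _ ⟨γ', two_pos, hc', he⟩ hγ', hg,
          ← surfaceMap_succ_comp_comulHead hA]
      · obtain rfl : k = 1 := by omega
        obtain ⟨γ', hγ', hE, hF, hH⟩ := γ.exists_loopContraction_point (by simpa using hk)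
          (Sum.inl 0) (VertexMap.joinRed 0 0 0 0)
        have hc' : γ'.Connected := fun v w => by
          rw [Subsingleton.elim v w]
        obtain ⟨g, he, hg⟩ := ih _ (by omega) γ' rfl one_pos hc'
        have hcp : (CellGraph.point (Fin (0 + 1) ⊕ Fin 0)).Connected := fun v w => by
          rw [Subsingleton.elim v w]
        obtain ⟨g₀, he₀, hg₀⟩ := ih 0 (by omega) (CellGraph.point (Fin (0 + 1) ⊕ Fin 0))
          (@Nat.card_of_isEmpty _ (inferInstanceAs (IsEmpty Empty))) one_pos hcp
        have : IsEmpty (CellGraph.point (Fin (0 + 1) ⊕ Fin 0)).HalfEdge :=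
          inferInstanceAs (IsEmpty Empty)
        have hF₀ := (CellGraph.point (Fin (0 + 1) ⊕ Fin 0)).numFaces_of_isEmpty
        rw [Nat.card_unique] at hF₀
        have hE₀ := (CellGraph.point (Fin (0 + 1) ⊕ Fin 0)).two_mul_numEdges
        rw [@Nat.card_of_isEmpty _ (inferInstanceAs (IsEmpty Empty))] at hE₀
        have he' : 0 + 1 + 0 + γ.numFaces + 2 * (g₀ + g) = γ.numEdges + 2 := by omega
        refine ⟨g₀ + g, he', ?_⟩
        refine (hΩ.red_separating g₀ 0 0 g 0 0 ⟨γ, hn, hc, he'⟩ ⟨_, one_pos, hcp, he₀⟩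
          ⟨γ', one_pos, hc', he⟩ hγ').trans ?_
        rw [hg, hg₀]
        exact (surfaceMap_comulPair hA hb g₀ 0 0 g 0 0).symm

end IsRibbonTQFT

end RibbonTQFT

/-! ### A graph of every type -/

theorem finRotate_mk {N i : ℕ} (hi : i < N) (h : i + 1 < N) :
    finRotate N ⟨i, hi⟩ = ⟨i + 1, h⟩ := by
  obtain ⟨N, rfl⟩ := Nat.exists_eq_succ_of_ne_zero (by omega : N ≠ 0)
  exact finRotate_of_lt (by omega)

theorem finRotate_mk_last {N i : ℕ} (hi : i < N) (h : i + 1 = N) :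
    finRotate N ⟨i, hi⟩ = ⟨0, by omega⟩ := by
  subst h
  exact finRotate_last'

namespace CellGraph

/-- The gluing of a surface with one boundary cycle: the half-edges `i < 4g` at the central vertex
are paired by `i ↔ i + 2g`, and the other ones are joined to the leaves. -/
def starOpp (g l : ℕ) : Fin (4 * g + l) ⊕ Fin l → Fin (4 * g + l) ⊕ Fin l :=
  Sum.elim (fun i =>
    if h₁ : i.val < 2 * g then Sum.inl ⟨i.val + 2 * g, by omega⟩
    else if h₂ : i.val < 4 * g then Sum.inl ⟨i.val - 2 * g, by omega⟩
    else Sum.inr ⟨i.val - 4 * g, by omega⟩) fun k => Sum.inl (Fin.natAdd (4 * g) k)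

theorem starOpp_inl_of_lt {g l i : ℕ} (hi : i < 4 * g + l) (h : i < 2 * g) :
    starOpp g l (Sum.inl ⟨i, hi⟩) = Sum.inl ⟨i + 2 * g, by omega⟩ := by
  simp [starOpp, h]

theorem starOpp_inl_of_le_of_lt {g l i : ℕ} (hi : i < 4 * g + l) (h : 2 * g ≤ i) (h' : i < 4 * g) :
    starOpp g l (Sum.inl ⟨i, hi⟩) = Sum.inl ⟨i - 2 * g, by omega⟩ := by
  simp [starOpp, h', not_lt.2 h]

theorem starOpp_inl_of_le {g l i : ℕ} (hi : i < 4 * g + l) (h : 4 * g ≤ i) :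
    starOpp g l (Sum.inl ⟨i, hi⟩) = Sum.inr ⟨i - 4 * g, by omega⟩ := by
  have h' : 2 * g ≤ i := by omega
  simp [starOpp, not_lt.2 h, not_lt.2 h']

theorem starOpp_starOpp (g l : ℕ) (x : Fin (4 * g + l) ⊕ Fin l) :
    starOpp g l (starOpp g l x) = x := by
  rcases x with ⟨i, hi⟩ | k
  · rcases Nat.lt_or_ge i (2 * g) with h | h
    · rw [starOpp_inl_of_lt hi h, starOpp_inl_of_le_of_lt _ (by omega) (by omega)]
      simp
    · rcases Nat.lt_or_ge i (4 * g) with h' | h'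
      · rw [starOpp_inl_of_le_of_lt hi h h', starOpp_inl_of_lt _ (by omega)]
        simp [Nat.sub_add_cancel h]
      · rw [starOpp_inl_of_le hi h']
        simp [starOpp, Nat.add_sub_cancel' h']
  · have h : starOpp g l (Sum.inr k) = Sum.inl ⟨4 * g + k, by omega⟩ := rfl
    rw [h, starOpp_inl_of_le _ (by omega)]
    simp

theorem starOpp_ne (g l : ℕ) (x : Fin (4 * g + l) ⊕ Fin l) : starOpp g l x ≠ x := by
  rcases x with ⟨i, hi⟩ | k
  · rcases Nat.lt_or_ge i (2 * g) with h | h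
    · rw [starOpp_inl_of_lt hi h, ne_eq, Sum.inl.injEq, Fin.mk.injEq]
      omega
    · rcases Nat.lt_or_ge i (4 * g) with h' | h'
      · rw [starOpp_inl_of_le_of_lt hi h h', ne_eq, Sum.inl.injEq, Fin.mk.injEq]
        omega
      · rw [starOpp_inl_of_le hi h']
        exact Sum.inr_ne_inl
  · exact Sum.inl_ne_inr

/-- The cyclic order of `starGraph`. -/
def starNext (g l : ℕ) : Equiv.Perm (Fin (4 * g + l) ⊕ Fin l) :=
  Equiv.sumCongr (finRotate (4 * g + l)) (Equiv.refl _)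

theorem starNext_sameCycle (g l : ℕ) (i j : Fin (4 * g + l)) :
    (starNext g l).SameCycle (Sum.inl i) (Sum.inl j) := by
  have key : ∀ (i : ℕ) (hi : i < 4 * g + l),
      (starNext g l).SameCycle (Sum.inl ⟨0, by omega⟩) (Sum.inl ⟨i, hi⟩) := by
    intro i
    induction i with
    | zero => intro _; exact Equiv.Perm.SameCycle.refl _ _
    | succ i ih =>
      intro hi
      have h := (starNext g l).sameCycle_pow 1 (Sum.inl ⟨i, by omega⟩)
      rw [pow_one, starNext, Equiv.sumCongr_apply, Sum.map_inl, finRotate_mk _ hi] at h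
      exact (ih (by omega)).trans h
  exact (key i i.2).symm.trans (key j j.2)

/-- A central vertex with `g` handles and `l` leaves, which has a single face. -/
def starGraph (g l : ℕ) : CellGraph (Option (Fin l)) where
  HalfEdge := Fin (4 * g + l) ⊕ Fin l
  finite := inferInstance
  opp := ⟨starOpp g l, starOpp g l, starOpp_starOpp g l, starOpp_starOpp g l⟩
  opp_opp := starOpp_starOpp g l
  opp_ne := starOpp_ne g l
  next := starNext g l
  vert := Sum.elim (fun _ => none) some
  sameCycle_iff := by
    intro x y
    constructor
    · refine Equiv.Perm.SameCycle.map_eq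
        (f := (Sum.elim (fun _ => none) some : _ → Option (Fin l))) ?_
      rintro (i | i) <;> rfl
    · rcases x with i | i <;> rcases y with j | j <;> intro h
      · exact starNext_sameCycle g l i j
      · simp at h
      · simp at h
      · obtain rfl : i = j := by simpa using h
        exact Equiv.Perm.SameCycle.refl _ _

theorem starGraph_connected (g l : ℕ) : (starGraph g l).Connected := by
  have h1 : ∀ k : Fin l, Relation.ReflTransGen (fun a b => ∃ x, (starGraph g l).vert x = a ∧
      (starGraph g l).vert ((starGraph g l).opp x) = b) none (some k) := by
    intro k
    refine .single ⟨(starGraph g l).opp (Sum.inr k), rfl, ?_⟩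
    exact congrArg (starGraph g l).vert ((starGraph g l).opp_opp (Sum.inr k))
  have h2 : ∀ k : Fin l, Relation.ReflTransGen (fun a b => ∃ x, (starGraph g l).vert x = a ∧
      (starGraph g l).vert ((starGraph g l).opp x) = b) (some k) none := fun k =>
    .single ⟨Sum.inr k, rfl, rfl⟩
  rintro (_ | v) (_ | w)
  · exact .refl
  · exact h1 w
  · exact h2 v
  · exact (h2 v).trans (h1 w)

theorem starGraph_numEdges (g l : ℕ) : (starGraph g l).numEdges = 2 * g + l := by
  have h := (starGraph g l).two_mul_numEdges
  have h2 : Nat.card (starGraph g l).HalfEdge = 4 * g + l + l := by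
    change Nat.card (Fin (4 * g + l) ⊕ Fin l) = _
    simp
  omega

/-- Two face steps take i to i + 2 for i ≤ 2g - 2, so 0 is joined to all even numbers up to 2g; one
step from 2g leads to 1 and hence to the odd ones. Each i in [2g, 4g) steps to i - 2g + 1. Beyond 4g
the face visits each leaf in turn and finally returns to 0. -/
theorem starGraph_face_sameCycle (g l : ℕ) (h0 : 0 < 4 * g + l)
    (x : Fin (4 * g + l) ⊕ Fin l) :
    ((starGraph g l).next * (starGraph g l).opp).SameCycle (Sum.inl ⟨0, h0⟩) x := by
  set φ : Equiv.Perm (Fin (4 * g + l) ⊕ Fin l) := (starGraph g l).next * (starGraph g l).opp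
  have hφ : ∀ x, φ.SameCycle x (starNext g l (starOpp g l x)) := fun x => φ.sameCycle_pow 1 x
  let z : Fin (4 * g + l) ⊕ Fin l := Sum.inl ⟨0, h0⟩
  have nxt : ∀ {i : ℕ} (hi : i < 4 * g + l) (h : i + 1 < 4 * g + l),
      starNext g l (Sum.inl ⟨i, hi⟩) = Sum.inl ⟨i + 1, h⟩ := fun hi h => by
    rw [starNext, Equiv.sumCongr_apply, Sum.map_inl, finRotate_mk hi h]
  have nxtl : ∀ {i : ℕ} (hi : i < 4 * g + l) (h : i + 1 = 4 * g + l),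
      starNext g l (Sum.inl ⟨i, hi⟩) = z := fun hi h => by
    rw [starNext, Equiv.sumCongr_apply, Sum.map_inl, finRotate_mk_last hi h]
  have toLeaf : ∀ k : Fin l, φ.SameCycle (Sum.inl (Fin.natAdd (4 * g) k)) (Sum.inr k) := by
    intro k
    have h := hφ (Sum.inl (Fin.natAdd (4 * g) k))
    have h2 : starOpp g l (Sum.inl (Fin.natAdd (4 * g) k)) = Sum.inr k :=
      starOpp_starOpp g l (Sum.inr k)
    rwa [h2] at h
  have leaf : ∀ d i : ℕ, ∀ hi : i < 4 * g + l, 4 * g ≤ i → i + d + 1 = 4 * g + l →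
      φ.SameCycle (Sum.inl ⟨i, hi⟩) z := by
    intro d
    induction d with
    | zero =>
      intro i hi hgi hd
      have h1 := toLeaf ⟨i - 4 * g, by omega⟩
      have h2 := hφ (Sum.inr ⟨i - 4 * g, by omega⟩)
      have h3 : (Fin.natAdd (4 * g) (⟨i - 4 * g, by omega⟩ : Fin l)) = ⟨i, hi⟩ :=
        Fin.ext (Nat.add_sub_cancel' hgi)
      have h4 : starOpp g l (Sum.inr ⟨i - 4 * g, by omega⟩) = Sum.inl ⟨i, hi⟩ :=
        congrArg Sum.inl h3
      rw [h3] at h1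
      rw [h4, nxtl hi (by omega)] at h2
      exact h1.trans h2
    | succ d ih =>
      intro i hi hgi hd
      have h1 := toLeaf ⟨i - 4 * g, by omega⟩
      have h2 := hφ (Sum.inr ⟨i - 4 * g, by omega⟩)
      have h3 : (Fin.natAdd (4 * g) (⟨i - 4 * g, by omega⟩ : Fin l)) = ⟨i, hi⟩ :=
        Fin.ext (Nat.add_sub_cancel' hgi)
      have h4 : starOpp g l (Sum.inr ⟨i - 4 * g, by omega⟩) = Sum.inl ⟨i, hi⟩ :=
        congrArg Sum.inl h3
      rw [h3] at h1
      rw [h4, nxt hi (by omega)] at h2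
      exact (h1.trans h2).trans (ih (i + 1) (by omega) (by omega) (by omega))
  have low : ∀ {i : ℕ} (hi : i < 4 * g + l) (h : i + 1 < 2 * g),
      φ.SameCycle (Sum.inl ⟨i, hi⟩) (Sum.inl ⟨i + 2 * g + 1, by omega⟩) := by
    intro i hi h
    have h1 := hφ (Sum.inl ⟨i, hi⟩)
    rwa [starOpp_inl_of_lt hi (by omega), nxt _ (by omega)] at h1
  have high : ∀ {i : ℕ} (hi : i < 4 * g + l) (h : 2 * g ≤ i) (h' : i < 4 * g),
      φ.SameCycle (Sum.inl ⟨i, hi⟩) (Sum.inl ⟨i - 2 * g + 1, by omega⟩) := by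
    intro i hi h h'
    have h1 := hφ (Sum.inl ⟨i, hi⟩)
    rwa [starOpp_inl_of_le_of_lt hi h h', nxt _ (by omega)] at h1
  have two : ∀ {i : ℕ} (hi : i + 2 ≤ 2 * g),
      φ.SameCycle (Sum.inl ⟨i, by omega⟩) (Sum.inl ⟨i + 2, by omega⟩) := by
    intro i hi
    refine (low (by omega) (by omega)).trans ?_
    have h1 := high (i := i + 2 * g + 1) (by omega) (by omega) (by omega)
    have h2 : i + 2 * g + 1 - 2 * g + 1 = i + 2 := by omega
    simpa only [h2] using h1
  have even : ∀ i, (hi : i ≤ g) → φ.SameCycle (Sum.inl ⟨2 * i, by omega⟩) z := by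
    intro i
    induction i with
    | zero => intro _; exact Equiv.Perm.SameCycle.refl _ _
    | succ i ih => intro hi; exact (two (i := 2 * i) (by omega)).symm.trans (ih (by omega))
  have one : ∀ hg : 0 < g, φ.SameCycle (Sum.inl ⟨1, by omega⟩) z := by
    intro hg
    have h1 := high (i := 2 * g) (by omega) le_rfl (by omega)
    simp only [Nat.sub_self] at h1
    exact h1.symm.trans (even g le_rfl)
  have upTo : ∀ i, (hi : i ≤ 2 * g) → φ.SameCycle (Sum.inl ⟨i, by omega⟩) z := by
    intro i
    induction i using Nat.strong_induction_on with
    | _ i ih =>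
      intro hi
      match i, ih with
      | 0, _ => exact Equiv.Perm.SameCycle.refl _ _
      | 1, _ => exact one (by omega)
      | i + 2, ih => exact (two (by omega)).symm.trans (ih i (by omega) (by omega))
  have all : ∀ i (hi : i < 4 * g + l), φ.SameCycle (Sum.inl ⟨i, hi⟩) z := by
    intro i hi
    rcases Nat.lt_or_ge (2 * g) i with h | h
    · rcases Nat.lt_or_ge i (4 * g) with h' | h'
      · exact (high hi h.le h').trans (upTo _ (by omega))
      · exact leaf (4 * g + l - i - 1) i hi h' (by omega)
    · exact upTo i h
  rcases x with ⟨i, hi⟩ | k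
  · exact (all i hi).symm
  · exact (all _ _).symm.trans (toLeaf k)

theorem starGraph_numFaces (g l : ℕ) : (starGraph g l).numFaces = 1 := by
  rcases Nat.eq_zero_or_pos (4 * g + l) with h0 | h0
  · obtain rfl : g = 0 := by omega
    obtain rfl : l = 0 := by omega
    have : IsEmpty (starGraph 0 0).HalfEdge := inferInstanceAs (IsEmpty (Fin 0 ⊕ Fin 0))
    rw [numFaces_of_isEmpty]
    simp
  · have h1 : numOrbits ((starGraph g l).next * (starGraph g l).opp) = 1 := by
      rw [numOrbits, Nat.card_eq_one_iff_unique]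
      have h := starGraph_face_sameCycle g l h0
      refine ⟨⟨fun a b => ?_⟩, ⟨⟦Sum.inl ⟨0, h0⟩⟧⟩⟩
      obtain ⟨a, rfl⟩ := Quotient.exists_rep a
      obtain ⟨b, rfl⟩ := Quotient.exists_rep b
      exact Quotient.sound ((h a).symm.trans (h b))
    have h2 : Function.Surjective (starGraph g l).vert := by
      rintro (_ | k)
      · exact ⟨Sum.inl ⟨0, h0⟩, rfl⟩
      · exact ⟨Sum.inr k, rfl⟩
    rw [CellGraph.numFaces, h1, card_isolated_eq_zero h2]

end CellGraph

/-- There is a two-colored cell graph of every type. -/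
theorem ColoredCellGraph.nonempty (g n m : ℕ) (hn : 0 < n) :
    Nonempty (ColoredCellGraph g n m) := by
  -- One vertex is the center of the star; the other l are its leaves.
  obtain ⟨l, hl⟩ : ∃ l, n + m = l + 1 := Nat.exists_eq_succ_of_ne_zero (by omega)
  let f : Option (Fin l) ≃ Fin n ⊕ Fin m :=
    (finSuccEquiv l).symm.trans ((finCongr hl.symm).trans finSumFinEquiv.symm)
  refine ⟨⟨(CellGraph.starGraph g l).relabel f, hn, (CellGraph.starGraph_connected g l).relabel f,
    ?_⟩⟩
  rw [CellGraph.numFaces_relabel, CellGraph.starGraph_numFaces]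
  change _ = (CellGraph.starGraph g l).numEdges + 2
  rw [CellGraph.starGraph_numEdges]
  omega

namespace CellGraph

/-- The symmetry of the star with two leaves. -/
theorem isIso_starGraph_swap : (starGraph 0 2).IsIso (starGraph 0 2)
    (Equiv.optionCongr (Equiv.swap 0 1))
    (Equiv.sumCongr (Equiv.swap (0 : Fin 2) 1) (Equiv.swap (0 : Fin 2) 1)) where
  opp := by
    change ∀ x : Fin 2 ⊕ Fin 2, Sum.map (Equiv.swap 0 1) (Equiv.swap 0 1) (starOpp 0 2 x) =
      starOpp 0 2 (Sum.map (Equiv.swap 0 1) (Equiv.swap 0 1) x)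
    decide
  next := by
    change ∀ x : Fin 2 ⊕ Fin 2, Sum.map (Equiv.swap 0 1) (Equiv.swap 0 1) (starNext 0 2 x) =
      starNext 0 2 (Sum.map (Equiv.swap 0 1) (Equiv.swap 0 1) x)
    decide
  vert := by
    rintro (i | i) <;> rfl

theorem isIso_relabel_starGraph_swap {V : Type} (f : Option (Fin 2) ≃ V) (p : V ≃ V)
    (hp : ∀ v, p (f v) = f (v.map (Equiv.swap 0 1))) :
    ((starGraph 0 2).relabel f).IsIso ((starGraph 0 2).relabel f) p
      (Equiv.sumCongr (Equiv.swap (0 : Fin 2) 1) (Equiv.swap (0 : Fin 2) 1)) where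
  opp := isIso_starGraph_swap.opp
  next := isIso_starGraph_swap.next
  vert x := (congrArg f (isIso_starGraph_swap.vert x)).trans (hp _).symm

end CellGraph

/-! ### Bicommutativity from ribbon graphs, and the equivalence -/

section RibbonTQFT

variable {K A : Type*} [Field K] [NonUnitalRing A] [Module K A]
    [IsScalarTower K A A] [SMulCommClass K A A] [Coalgebra K A]

open TensorOps

theorem TensorOps.idTensor_id (n : ℕ) :
    idTensor (LinearMap.id : ⨂[K]^n A →ₗ[K] ⨂[K]^n A) = LinearMap.id :=
  hom_ext_cons fun a t => by rw [idTensor_cons, LinearMap.lTensor_id]; rfl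

namespace IsRibbonTQFT

variable {Ω : RibbonMaps K A}

/-- The value on a graph with one red vertex, one blue vertex and one edge. -/
theorem apply_edge (hΩ : IsRibbonTQFT Ω) (hA : IsNearlyFrobenius K A)
    (γ : ColoredCellGraph 0 1 1) (hγ : Nat.card γ.HalfEdge = 2) :
    Ω 0 1 1 γ = LinearMap.id := by
  obtain ⟨x, hx, hx'⟩ := γ.connected.exists_edge (v := Sum.inl 0) (w := Sum.inr 0) (by simp)
  have hx2 : γ.vert (γ.opp x) = Sum.inr 0 := by
    rcases h : γ.vert (γ.opp x) with i | i
    · exact absurd (by rw [h, Subsingleton.elim i 0]) hx'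
    · rw [Subsingleton.elim i 0]
  obtain ⟨γ', hγ', hc, hE, hF, hH⟩ := γ.exists_edgeContraction γ.connected (x := x)
    (f := VertexMap.mixedToRed 0 0) (by rw [hx, hx2]; simp)
    (by rw [hx, hx2]; exact VertexMap.identifies_mixedToRed 0 0)
    (VertexMap.surjective_mixedToRed 0 0)
  rw [hx, hx2] at hγ'
  have he : 1 + 0 + γ'.numFaces + 2 * 0 = γ'.numEdges + 2 := by
    have := γ.euler
    omega
  have hempty : IsEmpty γ'.HalfEdge := by
    have := γ'.finite
    by_contra h
    rw [not_isEmpty_iff] at h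
    have := Nat.card_pos (α := γ'.HalfEdge)
    omega
  -- Contraction to red leaves a point with value ε, so the value is (id ⊗ ε) ∘ δ, the identity.
  rw [hΩ.mixed_edge_red 0 0 0 γ ⟨γ', one_pos, hc, he⟩ hγ', hΩ.base _ hempty,
    ← surfaceMap_zero_one_zero]
  exact (surfaceMap_idTensor_comulHead hA 0 0 0).symm.trans surfaceMap_cylinder

/-- The star with two red leaves and a blue center has value m, the one with two blue leaves and a
red center has value δ. Exchanging the leaves is an automorphism of the star, so both maps are
symmetric. -/
theorem isBicommutative (hΩ : IsRibbonTQFT Ω) (hA : IsNearlyFrobenius K A) :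
    IsBicommutative K A := by
  have hcard : Nat.card (CellGraph.starGraph 0 2).HalfEdge = 4 := by
    change Nat.card (Fin 2 ⊕ Fin 2) = 4
    simp
  have hconn := CellGraph.starGraph_connected 0 2
  have hF := CellGraph.starGraph_numFaces 0 2
  have hE := CellGraph.starGraph_numEdges 0 2
  refine .of_reindex (fun t => ?_) fun t => ?_
  · let f : Option (Fin 2) ≃ Fin 2 ⊕ Fin 1 :=
      { toFun := fun v => v.elim (Sum.inr 0) Sum.inl
        invFun := Sum.elim some fun _ => none
        left_inv := by rintro (_ | v) <;> rfl
        right_inv := by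
          rintro (v | v)
          · rfl
          · exact congrArg Sum.inr (Subsingleton.elim _ _) }
    let γ : ColoredCellGraph 0 2 1 :=
      ⟨(CellGraph.starGraph 0 2).relabel f, two_pos, hconn.relabel f, by
        rw [CellGraph.numFaces_relabel, hF]
        exact congrArg (· + 2) hE.symm⟩
    let x : γ.HalfEdge := (Sum.inr 0 : Fin (4 * 0 + 2) ⊕ Fin 2)
    obtain ⟨γ', hγ', hc, hE', hF', hH⟩ := γ.exists_edgeContraction γ.connected (x := x)
      (f := VertexMap.mixedToBlue 1 0) Sum.inl_ne_inr
      (VertexMap.identifies_mixedToBlue 1 0) (VertexMap.surjective_mixedToBlue 1 0)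
    have he : 1 + 1 + γ'.numFaces + 2 * 0 = γ'.numEdges + 2 := by
      have := γ.euler
      omega
    have key : Ω 0 2 1 γ = mulHead K A 0 := by
      rw [hΩ.mixed_edge_blue 0 1 0 γ ⟨γ', one_pos, hc, he⟩ hγ', hΩ.apply_edge hA, idTensor_id,
        LinearMap.comp_id]
      have : Nat.card γ.HalfEdge = 4 := hcard
      change Nat.card γ'.HalfEdge = 2
      omega
    have := hΩ.symmetry 0 2 1 γ γ (Equiv.swap 0 1) 1 _
      (CellGraph.isIso_relabel_starGraph_swap f _ (by rintro (_ | v) <;> rfl)) t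
    rwa [key, reindex_one] at this
  · let f : Option (Fin 2) ≃ Fin 1 ⊕ Fin 2 :=
      { toFun := fun v => v.elim (Sum.inl 0) Sum.inr
        invFun := Sum.elim (fun _ => none) some
        left_inv := by rintro (_ | v) <;> rfl
        right_inv := by
          rintro (v | v)
          · exact congrArg Sum.inl (Subsingleton.elim _ _)
          · rfl }
    let γ : ColoredCellGraph 0 1 2 :=
      ⟨(CellGraph.starGraph 0 2).relabel f, one_pos, hconn.relabel f, by
        rw [CellGraph.numFaces_relabel, hF]
        exact congrArg (· + 2) hE.symm⟩
    let x : γ.HalfEdge := (Sum.inl 0 : Fin (4 * 0 + 2) ⊕ Fin 2)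
    obtain ⟨γ', hγ', hc, hE', hF', hH⟩ := γ.exists_edgeContraction γ.connected (x := x)
      (f := VertexMap.mixedToRed 0 1) Sum.inl_ne_inr
      (VertexMap.identifies_mixedToRed 0 1) (VertexMap.surjective_mixedToRed 0 1)
    have he : 1 + 1 + γ'.numFaces + 2 * 0 = γ'.numEdges + 2 := by
      have := γ.euler
      omega
    have key : Ω 0 1 2 γ = comulHead K A 0 := by
      rw [hΩ.mixed_edge_red 0 0 1 γ ⟨γ', one_pos, hc, he⟩ hγ', hΩ.apply_edge hA, idTensor_id,
        LinearMap.id_comp]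
      have : Nat.card γ.HalfEdge = 4 := hcard
      change Nat.card γ'.HalfEdge = 2
      omega
    have := hΩ.symmetry 0 1 2 γ γ 1 (Equiv.swap 0 1) _
      (CellGraph.isIso_relabel_starGraph_swap f _ (by rintro (_ | v) <;> rfl)) t
    rw [key, reindex_one] at this
    exact this.symm

/-- A ribbon TQFT is determined by its algebra. -/
theorem eq_toRibbon (hΩ : IsRibbonTQFT Ω) (hA : IsNearlyFrobenius K A) :
    Ω = (surfaceMaps K A).toRibbon := by
  funext g n m γ
  obtain ⟨g', he, h⟩ := hΩ.determinedAt hA (hΩ.isBicommutative hA) γ.toCellGraph γ.pos γ.connected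
  -- Euler's formula determines the genus.
  obtain rfl : g = g' := by
    have := γ.euler
    omega
  exact h

end IsRibbonTQFT

/-- Every type is realized by some graph, on which the value can be read off. -/
theorem CobordismMaps.toRibbon_injective :
    Function.Injective (CobordismMaps.toRibbon : CobordismMaps K A → RibbonMaps K A) := by
  intro ω ω' h
  funext g n m hn
  obtain ⟨γ⟩ := ColoredCellGraph.nonempty g n m hn
  exact congrFun (congrFun (congrFun (congrFun h g) n) m) γ

end RibbonTQFT

theorem corollaryD {K A : Type*} [Field K] [NonUnitalRing A] [Module K A]
    [IsScalarTower K A A] [SMulCommClass K A A] [Coalgebra K A] (hA : IsNearlyFrobenius K A) :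
    (∀ ω : CobordismMaps K A, IsAlmostTQFT ω ↔ IsRibbonTQFT ω.toRibbon) ∧
      ∀ Ω : RibbonMaps K A, IsRibbonTQFT Ω →
        ∃! ω : CobordismMaps K A, IsAlmostTQFT ω ∧ ω.toRibbon = Ω := by
  refine ⟨fun ω => ⟨fun hω => ?_, fun hω => ?_⟩, fun Ω hΩ => ?_⟩
  · rw [hω.eq_surfaceMaps hA]
    exact isRibbonTQFT_surfaceMaps hA hω.isBicommutative
  · rw [CobordismMaps.toRibbon_injective (hω.eq_toRibbon hA)]
    exact isAlmostTQFT_surfaceMaps hA (hω.isBicommutative hA)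
  · exact ⟨surfaceMaps K A, ⟨isAlmostTQFT_surfaceMaps hA (hΩ.isBicommutative hA),
      (hΩ.eq_toRibbon hA).symm⟩, fun ω hω => hω.1.eq_surfaceMaps hA⟩
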